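/- Let $\Lambda\mathbb C^5$ be the space of polyforms on $\mathbb C^5$, with basic one-forms $e_1,\dots,e_5$, and let $a_j^\dagger=e_j\wedge$ and $a_j=e_j\lrcorner$. The Clifford generators $\Gamma_j=i(a_j-a_j^\dagger)$, $\Gamma_{j+5}=a_j+a_j^\dagger$ ($1\le j\le 5$) give the spinor representation of $\mathrm{Spin}(10)$ on $\Lambda\mathbb C^5$, with positive Weyl spinors $S_+=\Lambda^{\rm even}\mathbb C^5$. A spinor $\psi$ is pure if the space of $v\in\mathbb C^{10}=\mathbb R^{10}\otimes\mathbb C$ that annihilate it by Clifford multiplication has dimension $5$. Spinors $\phi,\psi$ are orthogonal if $\langle\phi,R\psi\rangle=0$, where $\langle\phi,\psi\rangle$ is the top-degree coefficient of $\sigma(\phi)\wedge\psi$ ($\sigma$ reverses the order of wedge products) and $R=\Gamma_6\Gamma_7\Gamma_8\Gamma_9\Gamma_{10}\,*$ with $*$ the complex conjugation of coefficients in the basis of wedge products of the $e_j$. Call $(\Psi_1,\Psi_2)$ an admissible pair if $\Psi_1,\Psi_2$ are pure and orthogonal and $a\Psi_1+b\Psi_2$ is pure for all $(a,b)\in\mathbb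 C^2\setminus\{0\}$, and let $$\mathrm{Stab}(\Psi_1,\Psi_2)=\{g\in\mathrm{Spin}(10): g\Psi_1=\Psi_1,\ g\Psi_2=c\,\Psi_2\text{ for some } c\in\mathrm U(1)\}.$$ The group $\mathrm{SU}(5)$ acts on $\Lambda\mathbb C^5$ by unitary transformations of the $e_j$; let $\mathrm{SU}(3)\times\mathrm{SU}(2)\times\mathrm U(1)_Y$ act through $(h_3,h_2,\alpha)\mapsto\mathrm{diag}(\alpha^{-2}h_3,\alpha^3h_2)\in\mathrm{SU}(5)$, where $\mathbb C^5=\mathbb C^3\oplus\mathbb C^2$ with $\mathbb C^3$ spanned by $e_1,e_2,e_3$ and $\mathbb C^2$ by $e_4,e_5$ (hypercharge $Y$ means that $\alpha$ acts by $\alpha^{6Y}$). Let $G_{\rm SM}\subset\mathrm{Spin}(10)$ be the subgroup of the elements that act on $\Lambda\mathbb C^5$ as an element of $\mathrm{SU}(3)\times\mathrm{SU}(2)\times\mathrm U(1)_Y$. The sterile neutrino direction $\bar\nu$ (respectively the direction $\bar e$) is the space of the $\mathrm{SU}(3)$- and $\mathrm{SU}(2)$-singlets in $S_+$ with $Y=0$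 (respectively $Y=1$). Theorem A. (1) Every element of $\mathrm{SU}(3)\times\mathrm{SU}(2)\times\mathrm U(1)_Y$ acts on $\Lambda\mathbb C^5$ as an element of $\mathrm{Spin}(10)$; the direction $\bar\nu$ is the line $\mathbb C\cdot 1$, and the direction $\bar e$ is the line $\mathbb C\cdot e_4\wedge e_5$. (2) If $\Psi_1\ne0$ lies in the direction $\bar\nu$ and $\Psi_2\neq0$ in the direction $\bar e$, then $(\Psi_1,\Psi_2)$ is an admissible pair and $\mathrm{Stab}(\Psi_1,\Psi_2)=G_{\rm SM}$. (3) For every admissible pair $(\Psi_1,\Psi_2)$ there is $h\in\mathrm{Spin}(10)$ with $\mathrm{Stab}(\Psi_1,\Psi_2)=h\,G_{\rm SM}\,h^{-1}$, and if $\Psi_1\in S_+$, then $h$ can be chosen such that moreover $h^{-1}\Psi_1$ lies in the direction $\bar\nu$ and $h^{-1}\Psi_2$ in the direction $\bar e$. (4) If $(\Psi_1,\Psi_2)$ is an admissible pair with $\Psi_1\in S_+$ and $\mathrm{Stab}(\Psi_1,\Psi_2)=G_{\rm SM}$, then $\Psi_1$ lies in the direction $\bar\nu$ and $\Psi_2$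 in the direction $\bar e$. -/

import Mathlib

open scoped ComplexConjugate

noncomputable section

namespace SpinTen

/-! ### The group `Spin(10)` -/

/-- The Euclidean space `ℝ¹⁰`. -/
abbrev V : Type := EuclideanSpace ℝ (Fin 10)

/-- The standard positive definite quadratic form `v ↦ ⟪v, v⟫` on `ℝ¹⁰`. -/
def Q : QuadraticForm ℝ V := LinearMap.BilinMap.toQuadraticMap (innerₗ V)

/-- `Spin(10)`, inside the Clifford algebra with relations `v * v = |v|²`.
The form being definite, these are the products of an even number of unit vectors. -/
abbrev Spin10 : Type := spinGroup Q

/-! ### Spinors as polyforms on `ℂ⁵` -/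

/-- The space of polyforms `Λ ℂ⁵`, i.e. of Dirac spinors. -/
abbrev S : Type := ExteriorAlgebra ℂ (Fin 5 → ℂ)

/-- The basic one-forms `e₁, …, e₅` (indexed from `0`). -/
def e (i : Fin 5) : S := ExteriorAlgebra.ι ℂ (Pi.single i 1)

/-- Creation operator: wedge product with `e i`. -/
def create (i : Fin 5) : Module.End ℂ S := LinearMap.mulLeft ℂ (e i)

/-- Annihilation operator: contraction with the `i`-th coordinate functional. -/
def annihilate (i : Fin 5) : Module.End ℂ S :=
  CliffordAlgebra.contractLeft (Q := (0 : QuadraticForm ℂ (Fin 5 → ℂ)))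
    (LinearMap.proj i : (Fin 5 → ℂ) →ₗ[ℂ] ℂ)

/-- The Clifford generators `Γ₁, …, Γ₁₀` (indexed from `0`): the first five are
`i (a_j - a_j†)`, the last five are `a_j + a_j†`. -/
def Gam : Fin 10 → Module.End ℂ S :=
  Fin.append (m := 5) (n := 5)
    (fun j => Complex.I • (annihilate j - create j))
    (fun j => annihilate j + create j)

/-- Clifford multiplication by a vector of the complexification `ℂ¹⁰` of `ℝ¹⁰`. -/
def cliffC : (Fin 10 → ℂ) →ₗ[ℂ] Module.End ℂ S := Fintype.linearCombination ℂ Gam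

/-- Clifford multiplication by a vector of `ℝ¹⁰`. -/
def cliff : V →ₗ[ℝ] Module.End ℂ S where
  toFun v := cliffC (fun A => (v A : ℂ))
  map_add' v w := by
    rw [← map_add]; congr 1; ext A; simp
  map_smul' r v := by
    have : (fun A => ((r • v) A : ℂ)) = (r : ℂ) • (fun A => (v A : ℂ)) := by
      ext A; simp
    rw [this, map_smul]; ext x; simp

theorem cliffC_apply (z : Fin 10 → ℂ) (x : S) :
    cliffC z x =
      CliffordAlgebra.contractLeft (Q := (0 : QuadraticForm ℂ (Fin 5 → ℂ)))
        (∑ j : Fin 5, (z (Fin.natAdd 5 j) + Complex.I * z (Fin.castAdd 5 j)) •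
          (LinearMap.proj j : (Fin 5 → ℂ) →ₗ[ℂ] ℂ)) x
      + ExteriorAlgebra.ι ℂ
        (fun j : Fin 5 => z (Fin.natAdd 5 j) - Complex.I * z (Fin.castAdd 5 j)) * x := by
  have hw : (fun j : Fin 5 => z (Fin.natAdd 5 j) - Complex.I * z (Fin.castAdd 5 j))
      = ∑ j : Fin 5, (z (Fin.natAdd 5 j) - Complex.I * z (Fin.castAdd 5 j)) •
          (Pi.single j 1 : Fin 5 → ℂ) := by
    ext k
    simp [Finset.sum_apply, Pi.single_apply]
  rw [hw, map_sum, map_sum, Finset.sum_mul, LinearMap.sum_apply, ← Finset.sum_add_distrib]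
  rw [cliffC, Fintype.linearCombination_apply, LinearMap.sum_apply]
  rw [show (∑ A : Fin 10, (z A • Gam A) x) = ∑ A : Fin (5 + 5), (z A • Gam A) x from rfl,
    Fin.sum_univ_add, ← Finset.sum_add_distrib]
  refine Finset.sum_congr rfl fun j _ => ?_
  have h1 : Gam (Fin.castAdd 5 j) = Complex.I • (annihilate j - create j) :=
    Fin.append_left _ _ j
  have h2 : Gam (Fin.natAdd 5 j) = annihilate j + create j := Fin.append_right _ _ j
  rw [h1, h2, map_smul, map_smul, smul_mul_assoc]
  simp only [LinearMap.smul_apply, LinearMap.sub_apply, LinearMap.add_apply]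
  change _ = _ • annihilate j x + _ • create j x
  module

theorem cliffC_cliffC (z : Fin 10 → ℂ) (x : S) :
    cliffC z (cliffC z x) = (∑ A, z A ^ 2) • x := by
  rw [cliffC_apply, cliffC_apply, map_add, CliffordAlgebra.contractLeft_contractLeft]
  rw [show ∀ (d : Module.Dual ℂ (Fin 5 → ℂ)) (w : Fin 5 → ℂ),
    CliffordAlgebra.contractLeft (Q := (0 : QuadraticForm ℂ (Fin 5 → ℂ))) d
      (ExteriorAlgebra.ι ℂ w * x) = d w • x - ExteriorAlgebra.ι ℂ w *
      CliffordAlgebra.contractLeft (Q := (0 : QuadraticForm ℂ (Fin 5 → ℂ))) d x from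
    fun d w => CliffordAlgebra.contractLeft_ι_mul d w x]
  rw [mul_add, ← mul_assoc, ExteriorAlgebra.ι_sq_zero, zero_mul, add_zero, zero_add,
    sub_add_cancel]
  congr 1
  rw [show (∑ A : Fin 10, z A ^ 2) = ∑ A : Fin (5 + 5), z A ^ 2 from rfl, Fin.sum_univ_add,
    ← Finset.sum_add_distrib, LinearMap.sum_apply]
  refine Finset.sum_congr rfl fun j _ => ?_
  simp only [LinearMap.smul_apply, LinearMap.proj_apply, smul_eq_mul]
  linear_combination (-(z (Fin.castAdd 5 j)) ^ 2) * Complex.I_sq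

theorem cliff_mul_self (v : V) :
    cliff v * cliff v = algebraMap ℝ (Module.End ℂ S) (Q v) := by
  apply LinearMap.ext
  intro x
  have h := cliffC_cliffC (fun A => (v A : ℂ)) x
  have hQ : Q v = ∑ A, v A ^ 2 := by
    simp [Q, EuclideanSpace.norm_sq_eq]
  rw [Module.End.mul_apply, Module.algebraMap_end_apply, hQ]
  change cliffC _ (cliffC _ x) = _
  rw [h, ← Complex.coe_smul]
  push_cast
  rfl

/-- The spinor representation of the Clifford algebra of `ℝ¹⁰` on polyforms. -/
def cliffordRep : CliffordAlgebra Q →ₐ[ℝ] Module.End ℂ S :=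
  CliffordAlgebra.lift Q ⟨cliff, cliff_mul_self⟩

/-- The spinor representation of `Spin(10)` on polyforms. -/
def spinRep : Spin10 →* Module.End ℂ S :=
  (cliffordRep : CliffordAlgebra Q →* Module.End ℂ S).comp (spinGroup Q).subtype

/-- Positive Weyl spinors: polyforms of even degree. -/
def Splus : Submodule ℂ S :=
  CliffordAlgebra.evenOdd (0 : QuadraticForm ℂ (Fin 5 → ℂ)) 0

/-! ### Pure spinors -/

/-- The space `M(ψ)` of complexified vectors that annihilate `ψ`. -/
def nullSpace (ψ : S) : Submodule ℂ (Fin 10 → ℂ) := LinearMap.ker (cliffC.flip ψ)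

/-- A spinor is pure if its space of annihilating vectors has the maximal dimension `5`.
(The zero spinor, annihilated by all of `ℂ¹⁰`, is not pure.) -/
def IsPure (ψ : S) : Prop := Module.finrank ℂ (nullSpace ψ) = 5

/-! ### The invariant pairing, the anti-linear map `R`, orthogonality -/

/-- The projection of polyforms to `Λ⁵ ℂ⁵ = ℂ`, with `e₁ ∧ ⋯ ∧ e₅ ↦ 1`. -/
def top : S →ₗ[ℂ] ℂ :=
  ExteriorAlgebra.liftAlternating
    (Pi.single (M := fun k => (Fin 5 → ℂ) [⋀^Fin k]→ₗ[ℂ] ℂ) 5 Matrix.detRowAlternating)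

/-- The invariant bilinear pairing `⟨φ, ψ⟩ = (σ(φ) ∧ ψ)|_top`, with `σ` the reversal of
the order of wedge products. -/
def pairing (φ ψ : S) : ℂ :=
  top (CliffordAlgebra.reverse (Q := (0 : QuadraticForm ℂ (Fin 5 → ℂ))) φ * ψ)

/-- Complex conjugation of polyforms: it conjugates the coefficients in the basis of wedge
products of the `e i`. -/
def conjS (ψ : S) : S :=
  ∑ I, conj ((Pi.basisFun ℂ (Fin 5)).ExteriorAlgebra.repr ψ I) •
    (Pi.basisFun ℂ (Fin 5)).ExteriorAlgebra I

/-- The anti-linear map `R = Γ₆ Γ₇ Γ₈ Γ₉ Γ₁₀ ∗`, which squares to the identity. -/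
def R (ψ : S) : S := Gam 5 (Gam 6 (Gam 7 (Gam 8 (Gam 9 (conjS ψ)))))

/-- Orthogonality of spinors: `⟨φ, R ψ⟩ = 0`. -/
def Orthogonal (φ ψ : S) : Prop := pairing φ (R ψ) = 0

/-- Two pure spinors, orthogonal to each other, all of whose (non-trivial) linear
combinations are pure. -/
structure PurePair (Ψ₁ Ψ₂ : S) : Prop where
  pure_left : IsPure Ψ₁
  pure_right : IsPure Ψ₂
  orthogonal : Orthogonal Ψ₁ Ψ₂
  pure_comb : ∀ a b : ℂ, (a, b) ≠ (0, 0) → IsPure (a • Ψ₁ + b • Ψ₂)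

theorem spinRep_inv_apply (g : Spin10) (ψ : S) : spinRep g⁻¹ (spinRep g ψ) = ψ := by
  rw [← Module.End.mul_apply, ← map_mul, inv_mul_cancel, map_one, Module.End.one_apply]

/-- The subgroup of `Spin(10)` that fixes `Ψ₁` and fixes `Ψ₂` up to a phase. -/
def stab (Ψ₁ Ψ₂ : S) : Subgroup Spin10 where
  carrier := {g | spinRep g Ψ₁ = Ψ₁ ∧ ∃ c : Circle, spinRep g Ψ₂ = (c : ℂ) • Ψ₂}
  one_mem' := by
    refine ⟨by simp, 1, by simp⟩
  mul_mem' := by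
    rintro g h ⟨hg, c, hc⟩ ⟨hh, d, hd⟩
    refine ⟨by rw [map_mul, Module.End.mul_apply, hh, hg], c * d, ?_⟩
    rw [map_mul, Module.End.mul_apply, hd, map_smul, hc, smul_smul, Circle.coe_mul, mul_comm]
  inv_mem' := by
    rintro g ⟨hg, c, hc⟩
    refine ⟨by have h := spinRep_inv_apply g Ψ₁; rwa [hg] at h, c⁻¹, ?_⟩
    have h := spinRep_inv_apply g Ψ₂
    rw [hc, map_smul] at h
    have h2 : ((c⁻¹ : Circle) : ℂ) * (c : ℂ) = 1 := by
      rw [← Circle.coe_mul, inv_mul_cancel, Circle.coe_one]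
    rw [← one_smul ℂ (spinRep g⁻¹ Ψ₂), ← h2, mul_smul, h]

/-! ### The Standard Model gauge group -/

/-- `SU(3) × SU(2) × U(1)`. -/
abbrev SM : Type :=
  Matrix.specialUnitaryGroup (Fin 3) ℂ × Matrix.specialUnitaryGroup (Fin 2) ℂ × Circle

/-- The block matrix `diag(α⁻² h₃, α³ h₂)`, for `ℂ⁵ = ℂ³ ⊕ ℂ²` with `ℂ³` spanned by the first
three and `ℂ²` by the last two basis vectors. With `α = exp(i φ / 6)` it is
`diag(exp(-i φ / 3) h₃, exp(i φ / 2) h₂)`. -/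
def smMatrix (x : SM) : Matrix (Fin 5) (Fin 5) ℂ :=
  Matrix.reindex (finSumFinEquiv (m := 3) (n := 2)) (finSumFinEquiv (m := 3) (n := 2))
    (Matrix.fromBlocks
      (((x.2.2 ^ (-2 : ℤ) : Circle) : ℂ) • (x.1 : Matrix (Fin 3) (Fin 3) ℂ)) 0
      0 (((x.2.2 ^ (3 : ℤ) : Circle) : ℂ) • (x.2.1 : Matrix (Fin 2) (Fin 2) ℂ)))

theorem smMatrix_one : smMatrix 1 = 1 := by
  simp [smMatrix]

theorem smMatrix_mul (x y : SM) : smMatrix (x * y) = smMatrix x * smMatrix y := by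
  simp only [smMatrix, Matrix.reindex_apply]
  rw [Matrix.submatrix_mul_equiv, Matrix.fromBlocks_multiply]
  simp [mul_pow, smul_smul, mul_comm]

theorem smMatrix_star (x : SM) : star (smMatrix x) = smMatrix x⁻¹ := by
  simp only [smMatrix, Matrix.star_eq_conjTranspose, Matrix.reindex_apply,
    Matrix.conjTranspose_submatrix, Matrix.fromBlocks_conjTranspose, Matrix.conjTranspose_smul,
    Matrix.conjTranspose_zero]
  simp only [Prod.fst_inv, Prod.snd_inv, inv_zpow, Circle.coe_inv_eq_conj]
  rfl

theorem smMatrix_mem (x : SM) : smMatrix x ∈ Matrix.specialUnitaryGroup (Fin 5) ℂ := by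
  rw [Matrix.mem_specialUnitaryGroup_iff, Matrix.mem_unitaryGroup_iff, smMatrix_star,
    ← smMatrix_mul, mul_inv_cancel, smMatrix_one]
  refine ⟨rfl, ?_⟩
  rw [smMatrix, Matrix.det_reindex_self, Matrix.det_fromBlocks_zero₂₁, Matrix.det_smul,
    Matrix.det_smul, (Matrix.mem_specialUnitaryGroup_iff.1 x.1.2).2,
    (Matrix.mem_specialUnitaryGroup_iff.1 x.2.1.2).2]
  simp only [Fintype.card_fin, mul_one, ← Circle.coe_pow, ← Circle.coe_mul]
  rw [← zpow_natCast, ← zpow_natCast, ← zpow_mul, ← zpow_mul, ← zpow_add]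
  simp

/-- The embedding of `SU(3) × SU(2) × U(1)` in `SU(5)`; its kernel is `ℤ/6`. -/
def smToSU5 : SM →* Matrix.specialUnitaryGroup (Fin 5) ℂ where
  toFun x := ⟨smMatrix x, smMatrix_mem x⟩
  map_one' := Subtype.ext smMatrix_one
  map_mul' x y := Subtype.ext (smMatrix_mul x y)

/-- The action of `SU(5)` on polyforms: unitary transformations of the basic one-forms. -/
def su5Rep : Matrix.specialUnitaryGroup (Fin 5) ℂ →* Module.End ℂ S where
  toFun U := (ExteriorAlgebra.map (Matrix.toLin' (U : Matrix (Fin 5) (Fin 5) ℂ))).toLinearMap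
  map_one' := by
    rw [Submonoid.coe_one, Matrix.toLin'_one, ExteriorAlgebra.map_id]
    rfl
  map_mul' U W := by
    rw [Submonoid.coe_mul, Matrix.toLin'_mul, ← ExteriorAlgebra.map_comp_map]
    rfl

/-- The action of `SU(3) × SU(2) × U(1)` on spinors. -/
def smRep : SM →* Module.End ℂ S := su5Rep.comp smToSU5

/-- The Standard Model gauge group `G_SM` in `SU(5)` in `Spin(10)`: the elements that act on
polyforms as an element of `SU(3) × SU(2) × U(1)`. -/
def GSM : Subgroup Spin10 := smRep.toHomUnits.range.comap spinRep.toHomUnits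

/-- The positive Weyl spinors that are singlets of `SU(3)` and of `SU(2)` and have hypercharge
`Y = k / 6`: the element `α = exp(i φ / 6)` of `U(1)` acts on them by `exp(i Y φ) = α ^ k`. -/
def singlet (k : ℤ) : Submodule ℂ S where
  carrier := {ψ | ψ ∈ Splus ∧ ∀ x : SM, smRep x ψ = ((x.2.2 ^ k : Circle) : ℂ) • ψ}
  add_mem' := by
    rintro ψ φ ⟨h, h'⟩ ⟨k, k'⟩
    exact ⟨add_mem h k, fun x => by rw [map_add, h', k', smul_add]⟩
  zero_mem' := ⟨zero_mem _, fun x => by simp⟩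
  smul_mem' := by
    rintro c ψ ⟨h, h'⟩
    exact ⟨Submodule.smul_mem _ c h, fun x => by rw [map_smul, h', smul_comm]⟩

/-- The sterile neutrino direction `ν̄`: colour and weak singlets with `Y = 0`. -/
def sterileNeutrino : Submodule ℂ S := singlet 0

/-- The direction `ē`: colour and weak singlets with `Y = 1`. -/
def positron : Submodule ℂ S := singlet 6

end SpinTen

end

open scoped ComplexConjugate

noncomputable section

namespace SpinTen

/-! ### Contractions and scalar parts of polyforms -/

/-! Under ℝ¹⁰ ≅ ℂ⁵ (`toComplex`) a real vector acts as the wedge product with some w plus the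
contraction with the conjugate of w. Wedge products and contractions are therefore complex
combinations of Clifford multiplications, and a polyform killed by all contractions is a scalar. The
proof brings every pair to a normal form and computes one stabiliser.

Normal form. The null space of a pure spinor is isotropic of dimension 5. The real and imaginary
parts of a Hermitian orthonormal basis of it, rescaled by √2, form an orthonormal basis of ℝ¹⁰. By
Cartan–Dieudonné a product of unit vectors moves this basis to the standard one, and the spinor to a
multiple of 1 (`IsPure.exists_cliffProd_eq_smul_one`). Orthogonality to 1 says that the second
spinor φ has no scalar part (`pairing_one_R`), and purity of 1 ± φ then forces φ = w ∧ u
(`exists_eq_ι_mul_ι`). Gram–Schmidt in SU(5), which fixes 1, moves φ to a multiple of `e 3 * e 4`.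
Elements of SU(5) are even products of unit vectors, by a Schur argument
(`exists_cliffProd_eq_su5Rep`).

Stabiliser. An element of Spin(10) fixing 1 acts through a matrix of SU(5)
(`exists_su5_of_spinRep_one`); if it also preserves the line of `e 3 * e 4`, the matrix is block
diagonal, hence in the image of SU(3) × SU(2) × U(1) (`stab_eq_GSM`). A product of an odd number of
vectors is made even by composing with `R`, which commutes with Spin(10) and so preserves
stabilisers (`stab_R`).

Directions. One torus element built from a 31st root of unity separates all even wedge products of
the `e i`, which determines the singlet lines. For the converse in (4), the second spinor is an even
weight vector, and invariance under a permutation cycling each block leaves only `e 3 * e 4`. -/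

/-- Contraction of polyforms with a covector. -/
abbrev contract (d : Module.Dual ℂ (Fin 5 → ℂ)) : Module.End ℂ S :=
  CliffordAlgebra.contractLeft (Q := (0 : QuadraticForm ℂ (Fin 5 → ℂ))) d

/-- The covector with coefficients `u`. -/
def covector : (Fin 5 → ℂ) →ₗ[ℂ] Module.Dual ℂ (Fin 5 → ℂ) :=
  Fintype.linearCombination ℂ (fun j => (LinearMap.proj j : (Fin 5 → ℂ) →ₗ[ℂ] ℂ))

theorem covector_eq_sum (u : Fin 5 → ℂ) :
    covector u = ∑ j, u j • (LinearMap.proj j : (Fin 5 → ℂ) →ₗ[ℂ] ℂ) := rfl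

theorem covector_apply (u w : Fin 5 → ℂ) : covector u w = ∑ j, u j * w j := by
  simp [covector_eq_sum]

theorem covector_single (j : Fin 5) : covector (Pi.single j 1) = LinearMap.proj j := by
  ext w; simp [covector_apply, Pi.single_apply, eq_comm]

theorem exists_covector_apply_eq_one {w : Fin 5 → ℂ} (hw : w ≠ 0) :
    ∃ u, covector u w = 1 := by
  obtain ⟨j, hj⟩ := Function.ne_iff.1 hw
  refine ⟨Pi.single j (w j)⁻¹, ?_⟩
  simp only [covector_apply, Pi.single_apply, ite_mul, zero_mul, Finset.sum_ite_eq',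
    Finset.mem_univ, if_true]
  exact inv_mul_cancel₀ hj

theorem contract_ι_mul (d : Module.Dual ℂ (Fin 5 → ℂ)) (w : Fin 5 → ℂ) (x : S) :
    contract d (ExteriorAlgebra.ι ℂ w * x)
      = d w • x - ExteriorAlgebra.ι ℂ w * contract d x :=
  CliffordAlgebra.contractLeft_ι_mul d w x

theorem contract_algebraMap (d : Module.Dual ℂ (Fin 5 → ℂ)) (r : ℂ) :
    contract d (algebraMap ℂ S r) = 0 :=
  CliffordAlgebra.contractLeft_algebraMap _ d r

theorem contract_one (d : Module.Dual ℂ (Fin 5 → ℂ)) : contract d (1 : S) = 0 :=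
  CliffordAlgebra.contractLeft_one _ d

/-- Induction on polyforms by left multiplication with vectors. -/
theorem polyform_induction {P : S → Prop} (algebraMap : ∀ r : ℂ, P (algebraMap ℂ S r))
    (add : ∀ x y, P x → P y → P (x + y))
    (ι_mul : ∀ w x, P x → P (ExteriorAlgebra.ι ℂ w * x)) (x : S) : P x :=
  CliffordAlgebra.left_induction (Q := (0 : QuadraticForm ℂ (Fin 5 → ℂ))) algebraMap add
    (fun x w h => ι_mul w x h) x

/-- The degree zero coefficient of a polyform. -/
abbrev scalarPart : S →ₐ[ℂ] ℂ := ExteriorAlgebra.algebraMapInv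

theorem scalarPart_ι (w : Fin 5 → ℂ) : scalarPart (ExteriorAlgebra.ι ℂ w) = 0 := by
  simp [ExteriorAlgebra.algebraMapInv]

theorem scalarPart_ι_mul (w : Fin 5 → ℂ) (x : S) :
    scalarPart (ExteriorAlgebra.ι ℂ w * x) = 0 := by
  rw [map_mul, scalarPart_ι, zero_mul]

section

variable {M : Type*} [AddCommGroup M] [Module ℂ M]

/-- `ιInv` is the degree one part, read off in the trivial square-zero extension, where only the
scalar part of x can contribute to a product with a vector. It serves to compare degree one parts in
`exists_eq_ι_mul_ι`. -/
theorem ιInv_ι_mul (w : M) (x : ExteriorAlgebra ℂ M) :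
    ExteriorAlgebra.ιInv (ExteriorAlgebra.ι ℂ w * x) = ExteriorAlgebra.algebraMapInv x • w := by
  let : Module ℂᵐᵒᵖ M := Module.compHom _ ((RingHom.id ℂ).fromOpposite mul_comm)
  have : IsCentralScalar ℂ M := ⟨fun r m => rfl⟩
  have h : (TrivSqZeroExt.fstHom ℂ ℂ M).comp (ExteriorAlgebra.toTrivSqZeroExt (R := ℂ) (M := M)) =
      ExteriorAlgebra.algebraMapInv := by
    ext m
    simp [ExteriorAlgebra.algebraMapInv]
  have h' : (ExteriorAlgebra.toTrivSqZeroExt x).fst = ExteriorAlgebra.algebraMapInv x :=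
    DFunLike.congr_fun h x
  change (ExteriorAlgebra.toTrivSqZeroExt (ExteriorAlgebra.ι ℂ w * x)).snd = _
  rw [map_mul, TrivSqZeroExt.snd_mul, ExteriorAlgebra.toTrivSqZeroExt_ι,
    TrivSqZeroExt.fst_inr, TrivSqZeroExt.snd_inr, h', zero_smul, zero_add, op_smul_eq_smul]

end

/-- Exactness of the Koszul complex: contraction with a covector dual to w is a contracting homotopy
for the wedge product with w. -/
theorem eq_ι_mul_contract {u w : Fin 5 → ℂ} {x : S} (h : ExteriorAlgebra.ι ℂ w * x = 0)
    (hu : covector u w = 1) : x = ExteriorAlgebra.ι ℂ w * contract (covector u) x := by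
  have h2 := contract_ι_mul (covector u) w x
  rw [h, map_zero, hu, one_smul] at h2
  exact (sub_eq_zero.1 h2.symm)

theorem ι_eq_sum (w : Fin 5 → ℂ) : ExteriorAlgebra.ι ℂ w = ∑ j, w j • e j := by
  simp only [e, ← map_smul, ← map_sum]
  congr 1
  ext k
  simp [Finset.sum_apply, Pi.single_apply]

/-- The number operator, multiplication by the degree. -/
def number : Module.End ℂ S := ∑ j, create j * annihilate j

theorem number_ι_mul (w : Fin 5 → ℂ) (x : S) :
    number (ExteriorAlgebra.ι ℂ w * x) =
      ExteriorAlgebra.ι ℂ w * x + ExteriorAlgebra.ι ℂ w * number x := by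
  have h2 : ∀ j, create j (annihilate j (ExteriorAlgebra.ι ℂ w * x)) =
      w j • (e j * x) + ExteriorAlgebra.ι ℂ w * (create j (annihilate j x)) := by
    intro j
    have h3 : annihilate j (ExteriorAlgebra.ι ℂ w * x) = w j • x -
      ExteriorAlgebra.ι ℂ w * annihilate j x := contract_ι_mul _ w x
    have h4 : e j * ExteriorAlgebra.ι ℂ w = - (ExteriorAlgebra.ι ℂ w * e j) :=
      eq_neg_of_add_eq_zero_left (ExteriorAlgebra.ι_add_mul_swap _ _)
    rw [h3]
    simp only [create, LinearMap.mulLeft_apply, mul_sub, mul_smul_comm]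
    rw [← mul_assoc, h4, neg_mul, sub_neg_eq_add, mul_assoc]
  simp only [number, LinearMap.sum_apply, Module.End.mul_apply, h2, Finset.sum_add_distrib,
    Finset.mul_sum]
  congr 1
  conv_rhs => rw [ι_eq_sum, Finset.sum_mul]
  simp only [smul_mul_assoc]

theorem number_ιMulti (n : ℕ) (v : Fin n → Fin 5 → ℂ) :
    number (ExteriorAlgebra.ιMulti ℂ n v) = (n : ℂ) • ExteriorAlgebra.ιMulti ℂ n v := by
  induction n with
  | zero =>
    simp only [ExteriorAlgebra.ιMulti_zero_apply, number, LinearMap.sum_apply,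
      Module.End.mul_apply, annihilate]
    simp [CliffordAlgebra.contractLeft_one]
  | succ n ih =>
    rw [ExteriorAlgebra.ιMulti_succ_apply, number_ι_mul, ih, mul_smul_comm]
    push_cast
    module

/-- The basis of wedge products of the `e i`. -/
abbrev wedgeBasis : Module.Basis (Finset (Fin 5)) ℂ S := (Pi.basisFun ℂ (Fin 5)).ExteriorAlgebra

theorem number_wedgeBasis (I : Finset (Fin 5)) :
    number (wedgeBasis I) = (I.card : ℂ) • wedgeBasis I := by
  rw [ExteriorAlgebra.basis_apply]
  exact number_ιMulti _ _

theorem wedgeBasis_empty : wedgeBasis ∅ = 1 := by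
  rw [ExteriorAlgebra.basis_apply_ofCard _ (Finset.card_empty)]
  exact ExteriorAlgebra.ιMulti_zero_apply _

/-- The number operator is built from contractions, so it kills x; being diagonal with eigenvalue
`I.card` on `wedgeBasis I`, it leaves only the coefficient at `∅`. -/
theorem eq_algebraMap_of_contract_eq_zero {x : S} (h : ∀ u, contract (covector u) x = 0) :
    x = algebraMap ℂ S (scalarPart x) := by
  have h0 : number x = 0 := by
    simp only [number, LinearMap.sum_apply, Module.End.mul_apply]
    refine Finset.sum_eq_zero fun j _ => ?_
    have := h (Pi.single j 1)
    rw [covector_single] at this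
    change create j (contract (LinearMap.proj j) x) = 0
    rw [this, map_zero]
  have h1 : ∀ I, (I.card : ℂ) * wedgeBasis.repr x I = 0 := by
    have h2 : number x = ∑ I, ((I.card : ℂ) * wedgeBasis.repr x I) • wedgeBasis I := by
      conv_lhs => rw [← wedgeBasis.sum_repr x]
      rw [map_sum]
      refine Finset.sum_congr rfl fun I _ => ?_
      rw [map_smul, number_wedgeBasis, smul_smul, mul_comm]
    rw [h0] at h2
    exact fun I => Fintype.linearIndependent_iff.1 wedgeBasis.linearIndependent _ h2.symm I
  have h3 : x = wedgeBasis.repr x ∅ • 1 := by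
    conv_lhs => rw [← wedgeBasis.sum_repr x]
    rw [Finset.sum_eq_single ∅, wedgeBasis_empty]
    · intro I _ hI
      have := h1 I
      rw [mul_eq_zero, Nat.cast_eq_zero, Finset.card_eq_zero] at this
      rw [this.resolve_left hI, zero_smul]
    · simp
  rw [← Algebra.algebraMap_eq_smul_one] at h3
  rw [h3, ExteriorAlgebra.algebraMap_leftInverse]

/-! ### Clifford multiplication in terms of wedge products and contractions -/

theorem cliffC_eq (z : Fin 10 → ℂ) (x : S) :
    cliffC z x = contract (covector
        (fun j => z (Fin.natAdd 5 j) + Complex.I * z (Fin.castAdd 5 j))) x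
      + ExteriorAlgebra.ι ℂ
        (fun j : Fin 5 => z (Fin.natAdd 5 j) - Complex.I * z (Fin.castAdd 5 j)) * x :=
  cliffC_apply z x

/-- The complex vector of `ℂ¹⁰` acting as contraction with `u` plus wedge product with `w`. -/
def lightcone (u w : Fin 5 → ℂ) : Fin 10 → ℂ :=
  Fin.append (m := 5) (n := 5) (fun j => (u j - w j) / (2 * Complex.I)) (fun j => (u j + w j) / 2)

theorem cliffC_lightcone (u w : Fin 5 → ℂ) (x : S) :
    cliffC (lightcone u w) x = contract (covector u) x + ExteriorAlgebra.ι ℂ w * x := by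
  rw [cliffC_eq]
  congr 4
  · ext j
    rw [lightcone, Fin.append_left, Fin.append_right]
    field_simp
    ring
  · ext j
    rw [lightcone, Fin.append_left, Fin.append_right]
    field_simp
    ring

theorem cliffC_anticomm (z z' : Fin 10 → ℂ) (x : S) :
    cliffC z (cliffC z' x) + cliffC z' (cliffC z x) = (2 * ∑ A, z A * z' A) • x := by
  have h := cliffC_cliffC (z + z') x
  have h1 := cliffC_cliffC z x
  have h2 := cliffC_cliffC z' x
  simp only [map_add, LinearMap.add_apply] at h
  rw [h1, h2] at h
  have h3 : ∑ A, (z + z') A ^ 2 = ∑ A, z A ^ 2 + 2 * ∑ A, z A * z' A + ∑ A, z' A ^ 2 := by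
    rw [Finset.mul_sum, ← Finset.sum_add_distrib, ← Finset.sum_add_distrib]
    refine Finset.sum_congr rfl fun A _ => ?_
    simp only [Pi.add_apply]; ring
  rw [h3, add_smul, add_smul] at h
  have h4 := sub_eq_zero.2 h
  rw [← sub_eq_zero, ← h4]
  abel

/-! ### Pure spinors with non-zero scalar part -/

/-- A spinor with non-zero scalar part is pure if every contraction of it is a wedge product of it
with a vector. -/
theorem isPure_iff_of_scalarPart_ne_zero {ψ : S} (h0 : scalarPart ψ ≠ 0) :
    IsPure ψ ↔ ∀ u, ∃ w, contract (covector u) ψ + ExteriorAlgebra.ι ℂ w * ψ = 0 := by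
  -- f keeps the contraction part of an annihilating vector. Once f is known to be injective,
  -- dimension 5 amounts to surjectivity.
  let f : nullSpace ψ →ₗ[ℂ] (Fin 5 → ℂ) :=
    { toFun := fun z => fun j => (z : Fin 10 → ℂ) (Fin.natAdd 5 j) +
        Complex.I * (z : Fin 10 → ℂ) (Fin.castAdd 5 j)
      map_add' := fun z z' => by ext j; simp; ring
      map_smul' := fun c z => by ext j; simp; ring }
  have hmem : ∀ z : nullSpace ψ, contract (covector (f z)) ψ + ExteriorAlgebra.ι ℂ (fun j : Fin 5 =>
      (z : Fin 10 → ℂ) (Fin.natAdd 5 j) - Complex.I * (z : Fin 10 → ℂ) (Fin.castAdd 5 j)) * ψ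
      = 0 := fun z => (cliffC_eq z ψ).symm.trans z.2
  -- Without contraction part, w ∧ ψ = 0; a non-zero w would divide ψ and so kill its scalar part.
  have hinj : Function.Injective f := by
    rw [← LinearMap.ker_eq_bot, LinearMap.ker_eq_bot']
    intro z hz
    have h := hmem z
    rw [hz, map_zero, contract, map_zero, LinearMap.zero_apply, zero_add] at h
    have hw : (fun j : Fin 5 => (z : Fin 10 → ℂ) (Fin.natAdd 5 j) -
        Complex.I * (z : Fin 10 → ℂ) (Fin.castAdd 5 j)) = 0 := by
      by_contra hw
      obtain ⟨u, hu⟩ := exists_covector_apply_eq_one hw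
      apply h0
      rw [eq_ι_mul_contract h hu, scalarPart_ι_mul]
    apply Subtype.ext
    have hA : ∀ A : Fin (5 + 5), (z : Fin 10 → ℂ) A = 0 := by
      intro A
      refine Fin.addCases (fun j => ?_) (fun j => ?_) A
      · have h1 := congrFun hz j
        have h2 := congrFun hw j
        simp only [Pi.zero_apply, f, LinearMap.coe_mk, AddHom.coe_mk] at h1 h2
        have : (2 * Complex.I) * (z : Fin 10 → ℂ) (Fin.castAdd 5 j) = 0 := by
          linear_combination h1 - h2
        simpa using this
      · have h1 := congrFun hz j
        have h2 := congrFun hw j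
        simp only [Pi.zero_apply, f, LinearMap.coe_mk, AddHom.coe_mk] at h1 h2
        linear_combination (h1 + h2) / 2
    exact funext hA
  constructor
  · intro hψ u
    have hsurj : Function.Surjective f := by
      refine (LinearMap.injective_iff_surjective_of_finrank_eq_finrank ?_).1 hinj
      rw [show Module.finrank ℂ (nullSpace ψ) = 5 from hψ]
      simp
    obtain ⟨z, hz⟩ := hsurj u
    have h := hmem z
    rw [hz] at h
    exact ⟨_, h⟩
  · intro h
    have hsurj : Function.Surjective f := by
      intro u
      obtain ⟨w, hw⟩ := h u
      refine ⟨⟨lightcone u w, (cliffC_lightcone u w ψ).trans hw⟩, ?_⟩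
      ext j
      change lightcone u w (Fin.natAdd 5 j) + Complex.I * lightcone u w (Fin.castAdd 5 j) = u j
      rw [lightcone, Fin.append_left, Fin.append_right]
      field_simp
      ring
    rw [IsPure, (LinearEquiv.ofBijective f ⟨hinj, hsurj⟩).finrank_eq]
    simp

/-- A spinor without scalar part whose combinations with `1` are pure is decomposable. -/
theorem exists_eq_ι_mul_ι {φ : S} (h0 : scalarPart φ = 0) (hφ : φ ≠ 0)
    (h1 : IsPure (1 + φ)) (h2 : IsPure (1 - φ)) :
    ∃ w u, φ = ExteriorAlgebra.ι ℂ w * ExteriorAlgebra.ι ℂ u := by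
  -- Comparing degree one parts shows that the vectors for 1 + φ and 1 - φ are opposite; the sum and
  -- the difference of the two equations then separate the two claims.
  have key : ∀ u, ∃ w, contract (covector u) φ = - ExteriorAlgebra.ι ℂ w ∧
      ExteriorAlgebra.ι ℂ w * φ = 0 := by
    intro u
    obtain ⟨w, hw⟩ := (isPure_iff_of_scalarPart_ne_zero (by simp [h0])).1 h1 u
    obtain ⟨w', hw'⟩ := (isPure_iff_of_scalarPart_ne_zero (by simp [h0])).1 h2 u
    rw [map_add, contract_one, zero_add] at hw
    rw [map_sub, contract_one, zero_sub] at hw'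
    have e1 := congrArg ExteriorAlgebra.ιInv hw
    have e2 := congrArg ExteriorAlgebra.ιInv hw'
    rw [map_add, ιInv_ι_mul, map_zero, map_add, h0, map_one, add_zero, one_smul] at e1
    rw [map_add, ιInv_ι_mul, map_zero, map_sub, h0, map_one, sub_zero, one_smul, map_neg] at e2
    have hww : w' = - w := by
      have h3 : w' = ExteriorAlgebra.ιInv (contract (covector u) φ) := by
        rw [← sub_eq_zero, ← e2]; abel
      rw [h3]
      exact eq_neg_of_add_eq_zero_left e1
    subst hww
    rw [mul_add, mul_one] at hw
    rw [mul_sub, mul_one, map_neg, neg_mul] at hw'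
    refine ⟨w, ?_, ?_⟩
    · have : (2 : ℂ) • (contract (covector u) φ + ExteriorAlgebra.ι ℂ w) = 0 := by
        rw [two_smul]
        rw [← sub_zero (0 : S)]
        nth_rw 1 [← hw]
        rw [← hw']
        abel
      exact eq_neg_of_add_eq_zero_left ((smul_eq_zero.1 this).resolve_left two_ne_zero)
    · have : (2 : ℂ) • (ExteriorAlgebra.ι ℂ w * φ) = 0 := by
        rw [two_smul]
        rw [← add_zero (0 : S)]
        nth_rw 1 [← hw]
        rw [← hw']
        abel
      exact (smul_eq_zero.1 this).resolve_left two_ne_zero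
  have : ∃ u, contract (covector u) φ ≠ 0 := by
    by_contra! h
    apply hφ
    rw [eq_algebraMap_of_contract_eq_zero h, h0, map_zero]
  obtain ⟨u, hu⟩ := this
  obtain ⟨w, hw, hw'⟩ := key u
  have hw0 : w ≠ 0 := by
    rintro rfl
    rw [map_zero, neg_zero] at hw
    exact hu hw
  -- As w ∧ φ = 0, φ is w wedge its contraction with a covector dual to w, and that contraction is
  -- again a one-form by `key`.
  obtain ⟨u', hu'⟩ := exists_covector_apply_eq_one hw0
  obtain ⟨v, hv, -⟩ := key u'
  refine ⟨w, -v, ?_⟩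
  rw [map_neg, ← hv]
  exact eq_ι_mul_contract hw' hu'

/-! ### Complex conjugation of polyforms -/

theorem conjS_add (x y : S) : conjS (x + y) = conjS x + conjS y := by
  simp [conjS, add_smul, Finset.sum_add_distrib]

theorem conjS_smul (c : ℂ) (x : S) : conjS (c • x) = conj c • conjS x := by
  simp [conjS, mul_smul, Finset.smul_sum]

theorem conjS_wedgeBasis (I : Finset (Fin 5)) : conjS (wedgeBasis I) = wedgeBasis I := by
  rw [conjS, Finset.sum_eq_single I]
  · simp [Module.Basis.repr_self]
  · intro J _ hJ
    rw [Module.Basis.repr_self, Finsupp.single_eq_of_ne hJ, map_zero, zero_smul]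
  · simp

/-- Complex conjugation of polyforms, as a semilinear map. -/
def conjLinear : S →ₛₗ[starRingEnd ℂ] S where
  toFun := conjS
  map_add' := conjS_add
  map_smul' := conjS_smul

theorem conjS_neg (x : S) : conjS (-x) = - conjS x := map_neg conjLinear x

theorem conjS_sub (x y : S) : conjS (x - y) = conjS x - conjS y := map_sub conjLinear x y

theorem conjS_zero : conjS 0 = 0 := map_zero conjLinear

theorem conjS_one : conjS 1 = 1 := by
  rw [← wedgeBasis_empty, conjS_wedgeBasis]

theorem conjS_algebraMap (r : ℂ) : conjS (algebraMap ℂ S r) = algebraMap ℂ S (conj r) := by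
  rw [Algebra.algebraMap_eq_smul_one, conjS_smul, conjS_one, Algebra.algebraMap_eq_smul_one]

theorem conjS_conjS (x : S) : conjS (conjS x) = x := by
  conv_rhs => rw [← wedgeBasis.sum_repr x]
  change conjLinear (conjLinear x) = _
  conv_lhs => rw [← wedgeBasis.sum_repr x]
  simp only [map_sum, LinearMap.map_smulₛₗ, Complex.conj_conj]
  refine Finset.sum_congr rfl fun I _ => ?_
  change _ • conjS (conjS _) = _
  rw [conjS_wedgeBasis, conjS_wedgeBasis]

theorem wedgeBasis_singleton (j : Fin 5) : wedgeBasis {j} = e j := by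
  rw [ExteriorAlgebra.basis_apply_ofCard _ (Finset.card_singleton j)]
  have h : (Set.powersetCard.ofFinEmbEquiv.symm
      (Set.powersetCard.ofCard (Finset.card_singleton j))) 0 = j := by
    have := (Set.powersetCard.mem_range_ofFinEmbEquiv_symm_iff_mem
      (Set.powersetCard.ofCard (Finset.card_singleton j)) j).2
      (by simp [Set.powersetCard.ofCard])
    obtain ⟨i, hi⟩ := this
    rwa [Subsingleton.elim i 0] at hi
  refine (ExteriorAlgebra.ιMulti_succ_apply (n := 0) _).trans ?_
  rw [ExteriorAlgebra.ιMulti_zero_apply, mul_one, Function.comp_apply, h, Pi.basisFun_apply, e]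

theorem e_mul_wedgeBasis_of_mem {j : Fin 5} {I : Finset (Fin 5)} (hj : j ∈ I) :
    e j * wedgeBasis I = 0 := by
  rw [← wedgeBasis_singleton]
  let s : Set.powersetCard (Fin 5) 1 := ⟨{j}, Finset.card_singleton j⟩
  let t : Set.powersetCard (Fin 5) I.card := ⟨I, rfl⟩
  refine ExteriorAlgebra.basis_mul_of_not_disjoint (Pi.basisFun ℂ (Fin 5)) s t ?_
  rw [Finset.not_disjoint_iff]
  exact ⟨j, Finset.mem_singleton_self j, hj⟩

theorem e_mul_wedgeBasis_of_notMem {j : Fin 5} {I : Finset (Fin 5)} (hj : j ∉ I) :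
    e j * wedgeBasis I = wedgeBasis (insert j I) ∨
      e j * wedgeBasis I = - wedgeBasis (insert j I) := by
  rw [← wedgeBasis_singleton]
  let s : Set.powersetCard (Fin 5) 1 := ⟨{j}, Finset.card_singleton j⟩
  let t : Set.powersetCard (Fin 5) I.card := ⟨I, rfl⟩
  have h : Disjoint s.val t.val := Finset.disjoint_singleton_left.2 hj
  have := ExteriorAlgebra.basis_mul_of_disjoint (Pi.basisFun ℂ (Fin 5)) s t h
  have hu : (Set.powersetCard.disjUnion h : Finset (Fin 5)) = insert j I := by
    rw [Finset.insert_eq]; ext i; simp [Set.powersetCard.disjUnion, s, t]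
  rw [hu] at this
  rcases Int.units_eq_one_or (Equiv.Perm.sign (Set.powersetCard.permOfDisjoint h)) with h1 | h1
  · left; rw [h1, one_smul] at this; exact this
  · right; rw [h1, Units.neg_smul, one_smul] at this; exact this

/-- Wedging with `e j` sends a basis element to zero or to plus or minus a basis element, so its
matrix is real. -/
theorem conjS_e_mul (j : Fin 5) (x : S) : conjS (e j * x) = e j * conjS x := by
  have h : ∀ I, conjS (e j * wedgeBasis I) = e j * wedgeBasis I := by
    intro I
    by_cases hj : j ∈ I
    · rw [e_mul_wedgeBasis_of_mem hj, conjS_zero]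
    · rcases e_mul_wedgeBasis_of_notMem hj with h | h
      · rw [h, conjS_wedgeBasis]
      · rw [h, conjS_neg, conjS_wedgeBasis]
  change conjLinear (e j * x) = e j * conjLinear x
  rw [← wedgeBasis.sum_repr x, Finset.mul_sum, map_sum, map_sum, Finset.mul_sum]
  refine Finset.sum_congr rfl fun I _ => ?_
  rw [mul_smul_comm, LinearMap.map_smulₛₗ, LinearMap.map_smulₛₗ, mul_smul_comm]
  congr 1
  exact (h I).trans (by rw [show conjLinear (wedgeBasis I) = _ from conjS_wedgeBasis I])

theorem conjS_ι_mul (w : Fin 5 → ℂ) (x : S) :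
    conjS (ExteriorAlgebra.ι ℂ w * x) = ExteriorAlgebra.ι ℂ (star w) * conjS x := by
  rw [ι_eq_sum, ι_eq_sum, Finset.sum_mul, Finset.sum_mul]
  change conjLinear _ = _
  rw [map_sum]
  refine Finset.sum_congr rfl fun j _ => ?_
  rw [smul_mul_assoc, LinearMap.map_smulₛₗ, smul_mul_assoc]
  exact congrArg _ (conjS_e_mul j x)

theorem covector_star (u w : Fin 5 → ℂ) : covector (star u) (star w) = conj (covector u w) := by
  simp [covector_apply]

theorem conjS_contract (u : Fin 5 → ℂ) (x : S) :
    conjS (contract (covector u) x) = contract (covector (star u)) (conjS x) := by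
  induction x using polyform_induction with
  | algebraMap r => rw [contract_algebraMap, conjS_algebraMap, contract_algebraMap, conjS_zero]
  | add x y hx hy => rw [map_add, conjS_add, conjS_add, map_add, hx, hy]
  | ι_mul w x hx =>
    rw [contract_ι_mul, conjS_ι_mul, contract_ι_mul, conjS_sub, conjS_smul, conjS_ι_mul, hx,
      covector_star]

theorem scalarPart_conjS (x : S) : scalarPart (conjS x) = conj (scalarPart x) := by
  induction x using polyform_induction with
  | algebraMap r => rw [conjS_algebraMap, AlgHom.commutes, AlgHom.commutes]; rfl
  | add x y hx hy => rw [conjS_add, map_add, map_add, map_add, hx, hy]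
  | ι_mul w x hx => rw [conjS_ι_mul, scalarPart_ι_mul, scalarPart_ι_mul, map_zero]

/-! ### The map `R` commutes with real Clifford multiplication -/

theorem cliffC_single (A : Fin 10) : cliffC (Pi.single A 1) = Gam A := by
  rw [cliffC, Fintype.linearCombination_apply_single, one_smul]

theorem Gam_natAdd (j : Fin 5) (x : S) :
    Gam (Fin.natAdd 5 j) x = contract (covector (Pi.single j 1)) x + e j * x := by
  rw [Gam, Fin.append_right, covector_single]; rfl

/-- The effect on vectors of conjugation with `Γ A`. -/
def flipExcept (A : Fin 10) (z : Fin 10 → ℂ) : Fin 10 → ℂ := fun B => if B = A then z B else - z B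

theorem Gam_cliffC (A : Fin 10) (z : Fin 10 → ℂ) (x : S) :
    Gam A (cliffC z x) = cliffC (flipExcept A z) (Gam A x) := by
  have h := cliffC_anticomm (Pi.single A 1) z x
  have h1 : flipExcept A z = (2 * z A) • Pi.single A 1 - z := by
    ext B
    by_cases hB : B = A
    · subst hB; simp [flipExcept]; ring
    · simp [flipExcept, hB]
  have h2 := cliffC_cliffC (Pi.single A 1) x
  rw [← cliffC_single, h1, map_sub, map_smul, LinearMap.sub_apply, LinearMap.smul_apply, h2]
  rw [← eq_sub_iff_add_eq] at h
  rw [h]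
  congr 1
  simp [Pi.single_apply]

theorem conjS_cliff (v : V) (x : S) :
    conjS (cliff v x) =
      cliffC (Fin.append (m := 5) (n := 5) (fun j => -(v (Fin.castAdd 5 j) : ℂ))
        (fun j => (v (Fin.natAdd 5 j) : ℂ))) (conjS x) := by
  change conjS (cliffC _ x) = _
  rw [cliffC_eq, cliffC_eq, conjS_add, conjS_contract, conjS_ι_mul]
  congr 4
  · ext j
    rw [Fin.append_left, Fin.append_right]
    simp
  · ext j
    rw [Fin.append_left, Fin.append_right]
    simp

/-- Conjugation flips the signs of the first five coordinates. Passing the last five generators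
gives each of these a sign (-1)⁵ and each of the last five coordinates a sign (-1)⁴, so all signs
cancel. -/
theorem R_cliff (v : V) (x : S) : R (cliff v x) = cliff v (R x) := by
  rw [R, conjS_cliff]
  simp only [Gam_cliffC]
  change cliffC _ _ = cliffC _ _
  congr 2
  ext A
  change Fin (5 + 5) at A
  refine Fin.addCases (fun j => ?_) (fun j => ?_) A
  · simp only [flipExcept, Fin.append_left]
    fin_cases j <;> simp +decide
  · simp only [flipExcept, Fin.append_right]
    fin_cases j <;> simp +decide

theorem R_smul (c : ℂ) (x : S) : R (c • x) = conj c • R x := by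
  simp only [R, conjS_smul, map_smul]

theorem R_add (x y : S) : R (x + y) = R x + R y := by
  simp only [R, conjS_add, map_add]

theorem Gam_Gam (A : Fin 10) (x : S) : Gam A (Gam A x) = x := by
  rw [← cliffC_single, cliffC_cliffC]
  have : ∑ B : Fin 10, (Pi.single A 1 : Fin 10 → ℂ) B ^ 2 = 1 := by simp [Pi.single_apply]
  rw [this, one_smul]

theorem Gam_mul_R (x : S) : Gam 9 (Gam 8 (Gam 7 (Gam 6 (Gam 5 (R x))))) = conjS x := by
  simp only [R, Gam_Gam]

theorem R_injective : Function.Injective R := by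
  intro x y h
  have h' := congrArg (fun x => Gam 9 (Gam 8 (Gam 7 (Gam 6 (Gam 5 x))))) h
  simp only [Gam_mul_R] at h'
  rw [← conjS_conjS x, h', conjS_conjS]

theorem R_cliffordRep (a : CliffordAlgebra Q) (x : S) :
    R (cliffordRep a x) = cliffordRep a (R x) := by
  induction a using CliffordAlgebra.induction generalizing x with
  | algebraMap r =>
    rw [AlgHom.commutes, Module.algebraMap_end_apply, Module.algebraMap_end_apply,
      ← Complex.coe_smul, R_smul, Complex.conj_ofReal, Complex.coe_smul]
  | ι v =>
    have : cliffordRep (CliffordAlgebra.ι Q v) = cliff v := CliffordAlgebra.lift_ι_apply _ _ _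
    rw [this, R_cliff]
  | mul a b ha hb => rw [map_mul, Module.End.mul_apply, ha, hb, Module.End.mul_apply]
  | add a b ha hb => rw [map_add, LinearMap.add_apply, R_add, ha, hb, LinearMap.add_apply]

theorem R_spinRep (g : Spin10) (x : S) : R (spinRep g x) = spinRep g (R x) :=
  R_cliffordRep g x

/-! ### Invariance of the pairing -/

theorem number_contract (d : Module.Dual ℂ (Fin 5 → ℂ)) (x : S) :
    number (contract d x) = contract d (number x) - contract d x := by
  induction x using polyform_induction with
  | algebraMap r =>
    have : number (algebraMap ℂ S r) = 0 := by
      rw [number, LinearMap.sum_apply]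
      refine Finset.sum_eq_zero fun j _ => ?_
      change create j (contract _ _) = 0
      rw [contract_algebraMap, map_zero]
    rw [this, contract_algebraMap, map_zero, map_zero, sub_zero]
  | add x y hx hy => simp only [map_add, hx, hy]; abel
  | ι_mul w x hx =>
    rw [contract_ι_mul, map_sub, map_smul, number_ι_mul, number_ι_mul, map_add, contract_ι_mul,
      contract_ι_mul, hx, mul_sub]
    abel

theorem top_ιMulti (n : ℕ) (hn : n ≠ 5) (v : Fin n → Fin 5 → ℂ) :
    top (ExteriorAlgebra.ιMulti ℂ n v) = 0 := by
  rw [top, ExteriorAlgebra.liftAlternating_apply_ιMulti, Pi.single_eq_of_ne hn]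
  rfl

theorem top_ιMulti_five (v : Fin 5 → Fin 5 → ℂ) :
    top (ExteriorAlgebra.ιMulti ℂ 5 v) = Matrix.det v := by
  rw [top, ExteriorAlgebra.liftAlternating_apply_ιMulti, Pi.single_eq_same]
  rfl

theorem top_number (x : S) : top (number x) = 5 * top x := by
  have : top.comp number = (5 : ℂ) • top := by
    refine wedgeBasis.ext fun I => ?_
    rw [LinearMap.comp_apply, number_wedgeBasis, map_smul, LinearMap.smul_apply]
    by_cases hI : I.card = 5
    · rw [hI]; rfl
    · rw [ExteriorAlgebra.basis_apply]
      have := top_ιMulti I.card hI (Pi.basisFun ℂ (Fin 5) ∘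
        (Set.powersetCard.ofFinEmbEquiv.symm (Set.powersetCard.prodEquiv.symm I).2))
      erw [this]
      simp
  exact LinearMap.congr_fun this x

theorem top_contract (d : Module.Dual ℂ (Fin 5 → ℂ)) (x : S) : top (contract d x) = 0 := by
  have : top.comp (contract d) = 0 := by
    refine wedgeBasis.ext fun I => ?_
    have h := top_number (contract d (wedgeBasis I))
    rw [number_contract, number_wedgeBasis, map_smul, map_sub, map_smul, smul_eq_mul] at h
    -- The contraction has degree `I.card - 1` while `top` sees only degree five; six indices are
    -- not available.
    have h2 : ((I.card : ℂ) - 6) * top (contract d (wedgeBasis I)) = 0 := by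
      linear_combination h
    refine (mul_eq_zero.1 h2).resolve_left fun h3 => ?_
    have h4 : (I.card : ℂ) = (6 : ℕ) := by linear_combination h3
    have h5 : I.card = 6 := by exact_mod_cast h4
    have := Finset.card_le_univ I
    simp only [Fintype.card_fin] at this
    omega
  exact LinearMap.congr_fun this x

theorem pairing_ι_mul (w : Fin 5 → ℂ) (φ ψ : S) :
    pairing (ExteriorAlgebra.ι ℂ w * φ) ψ = pairing φ (ExteriorAlgebra.ι ℂ w * ψ) := by
  rw [pairing, pairing, CliffordAlgebra.reverse.map_mul, CliffordAlgebra.reverse_ι, mul_assoc]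

theorem pairing_add_left (φ φ' ψ : S) : pairing (φ + φ') ψ = pairing φ ψ + pairing φ' ψ := by
  simp [pairing, add_mul]

theorem pairing_add_right (φ ψ ψ' : S) : pairing φ (ψ + ψ') = pairing φ ψ + pairing φ ψ' := by
  simp [pairing, mul_add]

theorem pairing_smul_left (c : ℂ) (φ ψ : S) : pairing (c • φ) ψ = c * pairing φ ψ := by
  simp [pairing]

theorem pairing_smul_right (c : ℂ) (φ ψ : S) : pairing φ (c • ψ) = c * pairing φ ψ := by
  simp [pairing]

theorem pairing_sub_left (φ φ' ψ : S) : pairing (φ - φ') ψ = pairing φ ψ - pairing φ' ψ := by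
  simp [pairing, sub_mul]

theorem pairing_sub_right (φ ψ ψ' : S) : pairing φ (ψ - ψ') = pairing φ ψ - pairing φ ψ' := by
  simp [pairing, mul_sub]

/-- For scalar φ both sides vanish, by `top_contract` on the right; vectors are then moved across
one at a time. With `pairing_ι_mul` this makes Clifford multiplication self-adjoint. -/
theorem pairing_contract (d : Module.Dual ℂ (Fin 5 → ℂ)) (φ ψ : S) :
    pairing (contract d φ) ψ = pairing φ (contract d ψ) := by
  induction φ using polyform_induction generalizing ψ with
  | algebraMap r =>
    rw [contract_algebraMap, pairing, pairing, map_zero, zero_mul, map_zero,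
      CliffordAlgebra.reverse.commutes, ← Algebra.smul_def, map_smul, top_contract, smul_zero]
  | add x y hx hy => rw [map_add, pairing_add_left, hx, hy, pairing_add_left]
  | ι_mul w x hx =>
    rw [contract_ι_mul, pairing_sub_left, pairing_smul_left, pairing_ι_mul, hx, contract_ι_mul,
      pairing_ι_mul, pairing_sub_right, pairing_smul_right]
    ring

theorem pairing_cliffC (z : Fin 10 → ℂ) (φ ψ : S) :
    pairing (cliffC z φ) ψ = pairing φ (cliffC z ψ) := by
  rw [cliffC_eq, cliffC_eq, pairing_add_left, pairing_contract, pairing_ι_mul, pairing_add_right]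

theorem pairing_cliffordRep (a : CliffordAlgebra Q) (φ ψ : S) :
    pairing (cliffordRep a φ) ψ = pairing φ (cliffordRep (CliffordAlgebra.reverse a) ψ) := by
  induction a using CliffordAlgebra.induction generalizing φ ψ with
  | algebraMap r =>
    rw [CliffordAlgebra.reverse.commutes, AlgHom.commutes, Module.algebraMap_end_apply,
      Module.algebraMap_end_apply, ← Complex.coe_smul, ← Complex.coe_smul, pairing_smul_left,
      pairing_smul_right]
  | ι v =>
    have : cliffordRep (CliffordAlgebra.ι Q v) = cliff v := CliffordAlgebra.lift_ι_apply _ _ _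
    rw [CliffordAlgebra.reverse_ι, this]
    exact pairing_cliffC _ _ _
  | mul a b ha hb =>
    rw [map_mul, Module.End.mul_apply, ha, hb, CliffordAlgebra.reverse.map_mul, map_mul,
      Module.End.mul_apply]
  | add a b ha hb =>
    rw [map_add, map_add, map_add, LinearMap.add_apply, LinearMap.add_apply, pairing_add_left,
      pairing_add_right, ha, hb]

/-- The adjoint of a Clifford element is its reversal, which on even elements is `star`, the inverse
in the spin group. -/
theorem pairing_spinRep (g : Spin10) (φ ψ : S) :
    pairing (spinRep g φ) (spinRep g ψ) = pairing φ ψ := by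
  change pairing (cliffordRep g φ) (cliffordRep g ψ) = _
  rw [pairing_cliffordRep, ← Module.End.mul_apply, ← map_mul]
  have h1 : CliffordAlgebra.reverse (g : CliffordAlgebra Q) = star (g : CliffordAlgebra Q) := by
    rw [CliffordAlgebra.star_def, spinGroup.involute_eq g.2]
  rw [h1, spinGroup.star_mul_self_of_mem g.2, map_one, Module.End.one_apply]

/-! ### Spinors orthogonal to `1` -/

/-- The wedge product of all basic one-forms, in increasing order. -/
def volume : S := ExteriorAlgebra.ιMulti ℂ 5 (Pi.basisFun ℂ (Fin 5))

theorem top_volume : top volume = 1 := by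
  rw [volume, top_ιMulti_five]
  have : (⇑(Pi.basisFun ℂ (Fin 5)) : Fin 5 → Fin 5 → ℂ) = (1 : Matrix (Fin 5) (Fin 5) ℂ) := by
    ext i j
    simp [Matrix.one_apply, Pi.single_apply, eq_comm]
  rw [this, Matrix.det_one]

theorem volume_eq : volume = e 0 * (e 1 * (e 2 * (e 3 * e 4))) := by
  simp only [volume, ExteriorAlgebra.ιMulti_succ_apply, ExteriorAlgebra.ιMulti_zero_apply, mul_one,
    Matrix.vecTail, Function.comp_apply, Pi.basisFun_apply, e]
  rfl

theorem contract_e (i j : Fin 5) (h : i ≠ j) (x : S) :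
    contract (covector (Pi.single i 1)) (e j * x) =
      - (e j * contract (covector (Pi.single i 1)) x) := by
  rw [e, contract_ι_mul, covector_apply]
  simp [Pi.single_apply, h.symm]

theorem Gam_one : Gam 9 (Gam 8 (Gam 7 (Gam 6 (Gam 5 (1 : S))))) =
    e 4 * (e 3 * (e 2 * (e 1 * (e 0 * 1)))) := by
  have h5 := Gam_natAdd 0
  have h6 := Gam_natAdd 1
  have h7 := Gam_natAdd 2
  have h8 := Gam_natAdd 3
  have h9 := Gam_natAdd 4
  simp only [Fin.isValue, Fin.reduceNatAdd] at h5 h6 h7 h8 h9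
  rw [h5, contract_one, zero_add, h6, contract_e _ _ (by decide), contract_one, mul_zero, neg_zero,
    zero_add, h7]
  repeat rw [contract_e _ _ (by decide)]
  rw [contract_one, mul_zero, neg_zero, mul_zero, neg_zero, zero_add, h8]
  repeat rw [contract_e _ _ (by decide)]
  rw [contract_one, mul_zero, neg_zero, mul_zero, neg_zero, mul_zero, neg_zero, zero_add, h9]
  repeat rw [contract_e _ _ (by decide)]
  rw [contract_one, mul_zero, neg_zero, mul_zero, neg_zero, mul_zero, neg_zero, mul_zero, neg_zero,
    zero_add]

theorem top_volume_mul (x : S) : top (volume * x) = scalarPart x := by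
  have h0 : ∀ w, volume * ExteriorAlgebra.ι ℂ w = 0 := by
    intro w
    have : volume * ExteriorAlgebra.ι ℂ w = ExteriorAlgebra.ιMulti ℂ (5 + 1)
        (Fin.append (Pi.basisFun ℂ (Fin 5)) (fun _ : Fin 1 => w)) := by
      rw [← ExteriorAlgebra.ιMulti_mul_ιMulti, volume]
      congr 1
      rw [ExteriorAlgebra.ιMulti_succ_apply, ExteriorAlgebra.ιMulti_zero_apply, mul_one]
    rw [this]
    -- Six vectors in ℂ⁵ are linearly dependent.
    refine AlternatingMap.map_linearDependent _ _ fun h => ?_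
    have := h.fintype_card_le_finrank
    simp at this
  induction x using polyform_induction with
  | algebraMap r =>
    rw [← Algebra.commutes, ← Algebra.smul_def, map_smul, top_volume, AlgHom.commutes]
    simp
  | add x y hx hy => rw [mul_add, map_add, map_add, hx, hy]
  | ι_mul w x hx => rw [← mul_assoc, h0, zero_mul, map_zero, scalarPart_ι_mul]

/-- Moved to the left argument, the five generators turn 1 into the reversed volume form; pairing
with the volume extracts the scalar part. -/
theorem pairing_one_R (ψ : S) : pairing 1 (R ψ) = conj (scalarPart ψ) := by
  rw [R]
  simp only [← cliffC_single]
  simp only [← pairing_cliffC]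
  simp only [cliffC_single]
  rw [Gam_one, ← scalarPart_conjS, ← top_volume_mul, volume_eq, pairing]
  congr 2
  simp [e, CliffordAlgebra.reverse.map_mul, CliffordAlgebra.reverse_ι, mul_assoc]

theorem orthogonal_smul_one_iff {c : ℂ} (hc : c ≠ 0) (ψ : S) :
    Orthogonal (c • 1) ψ ↔ scalarPart ψ = 0 := by
  rw [Orthogonal, pairing_smul_left, pairing_one_R, mul_eq_zero, map_eq_zero]
  simp [hc]

/-! ### Real Clifford multiplication -/

/-- The complex structure `ℝ¹⁰ ≃ ℂ⁵` for which `v` acts on polyforms as wedge product with `w`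
plus contraction with the conjugate of `w`. -/
def toComplex : V ≃ₗ[ℝ] (Fin 5 → ℂ) where
  toFun v := fun j => (v (Fin.natAdd 5 j) : ℂ) - Complex.I * (v (Fin.castAdd 5 j) : ℂ)
  map_add' v w := by ext j; simp; ring
  map_smul' r v := by ext j; simp; ring
  invFun w := WithLp.toLp 2
    (Fin.append (m := 5) (n := 5) (fun j => -(w j).im) (fun j => (w j).re))
  left_inv v := by
    ext A
    change Fin (5 + 5) at A
    refine Fin.addCases (fun j => ?_) (fun j => ?_) A
    · rw [PiLp.toLp_apply, Fin.append_left]; simp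
    · rw [PiLp.toLp_apply, Fin.append_right]; simp
  right_inv w := by
    ext j
    dsimp only
    rw [Fin.append_left, Fin.append_right]
    apply Complex.ext <;> simp

theorem cliff_eq (v : V) (x : S) :
    cliff v x = contract (covector (star (toComplex v))) x +
      ExteriorAlgebra.ι ℂ (toComplex v) * x := by
  change cliffC _ x = _
  rw [cliffC_eq]
  congr 4
  ext j
  simp [toComplex]

theorem norm_sq_toComplex (v : V) : ∑ j, ‖toComplex v j‖ ^ 2 = ‖v‖ ^ 2 := by
  rw [EuclideanSpace.norm_sq_eq, show (∑ A : Fin 10, ‖v A‖ ^ 2) = ∑ A : Fin (5 + 5), ‖v A‖ ^ 2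
    from rfl, Fin.sum_univ_add, ← Finset.sum_add_distrib]
  refine Finset.sum_congr rfl fun j _ => ?_
  rw [← Complex.normSq_eq_norm_sq, Complex.normSq_apply]
  simp [toComplex]
  ring

theorem cliffC_eq_cliff (z : Fin 10 → ℂ) (x : S) :
    cliffC z x = cliff (WithLp.toLp 2 fun A => (z A).re) x +
      Complex.I • cliff (WithLp.toLp 2 fun A => (z A).im) x := by
  have : z = (fun A => ((z A).re : ℂ)) + Complex.I • (fun A => ((z A).im : ℂ)) := by
    ext A
    simp only [Pi.add_apply, Pi.smul_apply, smul_eq_mul]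
    rw [mul_comm, Complex.re_add_im]
  conv_lhs => rw [this, map_add, map_smul]
  rfl

theorem cliff_single (A : Fin 10) : cliff (EuclideanSpace.single A 1) = Gam A := by
  rw [← cliffC_single]
  change cliffC _ = _
  congr 1
  ext B
  by_cases hB : B = A
  · subst hB; simp
  · simp [hB]

theorem cliff_cliff (v : V) (x : S) : cliff v (cliff v x) = ((‖v‖ ^ 2 : ℝ) : ℂ) • x := by
  have h := LinearMap.congr_fun (cliff_mul_self v) x
  rw [Module.End.mul_apply, Module.algebraMap_end_apply] at h
  rw [h, Complex.coe_smul]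
  simp [Q]

theorem cliff_cliff_of_norm_eq_one {v : V} (hv : ‖v‖ = 1) (x : S) : cliff v (cliff v x) = x := by
  rw [cliff_cliff, hv]; simp

theorem cliff_anticomm (v w : V) (x : S) :
    cliff v (cliff w x) + cliff w (cliff v x) = ((2 * inner ℝ v w : ℝ) : ℂ) • x := by
  have h := cliff_cliff (v + w) x
  simp only [map_add, LinearMap.add_apply, cliff_cliff] at h
  rw [norm_add_sq_real] at h
  push_cast at h ⊢
  rw [add_smul, add_smul] at h
  rw [← sub_eq_zero] at h ⊢
  rw [← h]
  abel

/-! ### Products of unit vectors -/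

/-- The action on spinors of a product of vectors. -/
def cliffProd (l : List V) : Module.End ℂ S := (l.map cliff).prod

/-- A list of unit vectors. -/
def IsUnitList (l : List V) : Prop := ∀ v ∈ l, ‖v‖ = 1

theorem cliffProd_nil (x : S) : cliffProd [] x = x := rfl

theorem cliffProd_cons (v : V) (l : List V) (x : S) :
    cliffProd (v :: l) x = cliff v (cliffProd l x) := by
  simp [cliffProd]

theorem cliffProd_append (l l' : List V) (x : S) :
    cliffProd (l ++ l') x = cliffProd l (cliffProd l' x) := by
  simp [cliffProd]

theorem isUnitList_cons {v : V} {l : List V} : IsUnitList (v :: l) ↔ ‖v‖ = 1 ∧ IsUnitList l := by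
  simp [IsUnitList]

theorem IsUnitList.append {l l' : List V} (h : IsUnitList l) (h' : IsUnitList l') :
    IsUnitList (l ++ l') := by
  intro v hv
  rcases List.mem_append.1 hv with hv | hv
  exacts [h v hv, h' v hv]

theorem IsUnitList.reverse {l : List V} (h : IsUnitList l) : IsUnitList l.reverse :=
  fun v hv => h v (List.mem_reverse.1 hv)

theorem IsUnitList.cliffProd_reverse_cliffProd {l : List V} (hl : IsUnitList l) (x : S) :
    cliffProd l.reverse (cliffProd l x) = x := by
  induction l generalizing x with
  | nil => rfl
  | cons v l ih =>
    rw [isUnitList_cons] at hl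
    rw [List.reverse_cons, cliffProd_append, cliffProd_cons, cliffProd_cons, cliffProd_nil,
      cliff_cliff_of_norm_eq_one hl.1, ih hl.2]

theorem IsUnitList.cliffProd_cliffProd_reverse {l : List V} (hl : IsUnitList l) (x : S) :
    cliffProd l (cliffProd l.reverse x) = x := by
  simpa using hl.reverse.cliffProd_reverse_cliffProd x

theorem IsUnitList.pairing_cliffProd {l : List V} (hl : IsUnitList l) (φ ψ : S) :
    pairing (cliffProd l φ) (cliffProd l ψ) = pairing φ ψ := by
  induction l with
  | nil => rfl
  | cons v l ih =>
    rw [isUnitList_cons] at hl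
    rw [cliffProd_cons, cliffProd_cons, show cliff v (cliffProd l φ) = cliffC _ (cliffProd l φ)
      from rfl, pairing_cliffC]
    change pairing _ (cliff v (cliff v _)) = _
    rw [cliff_cliff_of_norm_eq_one hl.1, ih hl.2]

theorem R_cliffProd (l : List V) (x : S) : R (cliffProd l x) = cliffProd l (R x) := by
  induction l with
  | nil => rfl
  | cons v l ih => rw [cliffProd_cons, R_cliff, ih, cliffProd_cons]

/-- A unit vector squares to 1 and `star` negates it, so a product p of n of them satisfies `star p
* p = (-1) ^ n`. Even n thus gives unitarity as well as even degree. -/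
theorem IsUnitList.exists_spinRep_eq {l : List V} (hl : IsUnitList l) (hl' : Even l.length) :
    ∃ g : Spin10, spinRep g = cliffProd l := by
  have hunit : ∀ v : V, ‖v‖ = 1 → CliffordAlgebra.ι Q v * CliffordAlgebra.ι Q v = 1 := by
    intro v hv
    have hQ : Q v = 1 := by simp [Q, hv]
    rw [CliffordAlgebra.ι_sq_scalar, hQ, map_one]
  have hmem : ∀ l : List V, IsUnitList l → (l.map (CliffordAlgebra.ι Q)).prod ∈
      (lipschitzGroup Q).toSubmonoid.map (Units.coeHom <| CliffordAlgebra Q) := by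
    intro l hl
    refine Submonoid.list_prod_mem _ fun x hx => ?_
    obtain ⟨v, hv, rfl⟩ := List.mem_map.1 hx
    refine ⟨⟨_, _, hunit v (hl v hv), hunit v (hl v hv)⟩, Subgroup.subset_closure ⟨v, rfl⟩, rfl⟩
  have hstar : ∀ l : List V, IsUnitList l →
      star (l.map (CliffordAlgebra.ι Q)).prod * (l.map (CliffordAlgebra.ι Q)).prod =
        (-1) ^ l.length ∧
      (l.map (CliffordAlgebra.ι Q)).prod * star (l.map (CliffordAlgebra.ι Q)).prod =
        (-1) ^ l.length := by
    intro l
    induction l with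
    | nil => simp
    | cons v l ih =>
      intro hl
      rw [isUnitList_cons] at hl
      obtain ⟨h1, h2⟩ := ih hl.2
      rw [List.map_cons, List.prod_cons, star_mul, CliffordAlgebra.star_ι, List.length_cons,
        pow_succ]
      constructor
      · rw [mul_assoc, ← mul_assoc (-CliffordAlgebra.ι Q v), neg_mul, hunit v hl.1, ← h1]
        simp
      · rw [mul_assoc, ← mul_assoc _ (star _), h2]
        rcases neg_one_pow_eq_or (CliffordAlgebra Q) l.length with h | h <;> rw [h] <;>
          simp [hunit v hl.1]
  have heven : ∀ l : List V, (l.map (CliffordAlgebra.ι Q)).prod ∈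
      CliffordAlgebra.evenOdd Q (l.length : ZMod 2) := by
    intro l
    induction l with
    | nil => simpa using Submodule.one_le.1 (CliffordAlgebra.one_le_evenOdd_zero Q)
    | cons v l ih =>
      rw [List.map_cons, List.prod_cons, List.length_cons, Nat.cast_succ, add_comm]
      exact CliffordAlgebra.evenOdd_mul_le Q _ _
        (Submodule.mul_mem_mul (CliffordAlgebra.ι_mem_evenOdd_one Q v) ih)
  have h0 : ((l.length : ℕ) : ZMod 2) = 0 := (ZMod.natCast_eq_zero_iff_even).2 hl'
  refine ⟨⟨(l.map (CliffordAlgebra.ι Q)).prod, ⟨hmem l hl, ?_⟩, ?_⟩, ?_⟩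
  · rw [SetLike.mem_coe, Unitary.mem_iff]
    have := hstar l hl
    rwa [hl'.neg_one_pow] at this
  · have := heven l
    rw [h0] at this
    exact this
  · change cliffordRep (l.map (CliffordAlgebra.ι Q)).prod = _
    rw [map_list_prod, List.map_map, cliffProd]
    congr 2
    ext v : 1
    exact CliffordAlgebra.lift_ι_apply _ _ _

/-! ### Parity of spinors -/

/-- The automorphism of polyforms which is the sign of the degree. -/
abbrev parity : S →ₐ[ℂ] S := CliffordAlgebra.involute (Q := (0 : QuadraticForm ℂ (Fin 5 → ℂ)))

theorem parity_ι_mul (w : Fin 5 → ℂ) (x : S) :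
    parity (ExteriorAlgebra.ι ℂ w * x) = - (ExteriorAlgebra.ι ℂ w * parity x) := by
  rw [map_mul, CliffordAlgebra.involute_ι, neg_mul]

theorem parity_contract (d : Module.Dual ℂ (Fin 5 → ℂ)) (x : S) :
    parity (contract d x) = - contract d (parity x) := by
  induction x using polyform_induction with
  | algebraMap r =>
    rw [contract_algebraMap, AlgHom.commutes, contract_algebraMap, map_zero, neg_zero]
  | add x y hx hy => rw [map_add, map_add, hx, hy, map_add, map_add, neg_add]
  | ι_mul w x hx =>
    rw [contract_ι_mul, map_sub, map_smul, parity_ι_mul, parity_ι_mul, map_neg, contract_ι_mul, hx]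
    simp

theorem parity_cliff (v : V) (x : S) : parity (cliff v x) = - cliff v (parity x) := by
  rw [cliff_eq, cliff_eq, map_add, parity_contract, parity_ι_mul, neg_add]

theorem parity_cliffProd (l : List V) (x : S) :
    parity (cliffProd l x) = (-1 : ℂ) ^ l.length • cliffProd l (parity x) := by
  induction l with
  | nil => simp [cliffProd_nil]
  | cons v l ih =>
    rw [cliffProd_cons, parity_cliff, ih, map_smul, List.length_cons, pow_succ, cliffProd_cons]
    simp

theorem parity_of_mem_Splus {x : S} (hx : x ∈ Splus) : parity x = x :=
  CliffordAlgebra.involute_eq_of_mem_even hx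

/-! ### Lifting isometries to products of unit vectors -/

theorem cliff_reflection {v : V} (hv : ‖v‖ = 1) (w : V) (x : S) :
    cliff (Submodule.reflection (ℝ ∙ v)ᗮ w) (cliff v x) = - cliff v (cliff w x) := by
  have h1 : Submodule.reflection (ℝ ∙ v)ᗮ w = w - (2 * inner ℝ v w) • v := by
    rw [Submodule.reflection_orthogonal_apply, Submodule.reflection_singleton_apply, hv]
    simp [mul_smul, two_smul]
  have h2 := cliff_anticomm v w x
  rw [h1, map_sub, map_smul, LinearMap.sub_apply, LinearMap.smul_apply,
    cliff_cliff_of_norm_eq_one hv, ← Complex.coe_smul, ← h2]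
  abel

/-- Cartan–Dieudonné: f is a product of reflections, each implemented up to sign by its unit normal.
-/
theorem exists_unitList (f : V ≃ₗᵢ[ℝ] V) : ∃ l, IsUnitList l ∧ ∀ w x,
    cliff (f w) (cliffProd l x) = (-1 : ℂ) ^ l.length • cliffProd l (cliff w x) := by
  obtain ⟨l, -, rfl⟩ := f.reflections_generate_dim
  induction l with
  | nil => exact ⟨[], by simp [IsUnitList], by simp [cliffProd_nil]⟩
  | cons v l ih =>
    obtain ⟨l', hl', h⟩ := ih
    simp only [List.map_cons, List.prod_cons]
    -- The decomposition may contain zero vectors, whose reflection is the identity; they are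
    -- dropped.
    by_cases hv : v = 0
    · refine ⟨l', hl', fun w x => ?_⟩
      rw [← h, hv]
      congr 2
      rw [LinearIsometryEquiv.coe_mul, Function.comp_apply]
      exact Submodule.reflection_mem_subspace_eq_self (by simp)
    · have hn : ‖v‖ ≠ 0 := norm_ne_zero_iff.2 hv
      have hs : (ℝ ∙ v) = (ℝ ∙ (‖v‖⁻¹ • v)) :=
        (Submodule.span_singleton_smul_eq (IsUnit.mk0 _ (inv_ne_zero hn)) v).symm
      have h1 : ‖(‖v‖⁻¹ • v)‖ = 1 := by
        rw [norm_smul, norm_inv, norm_norm, inv_mul_cancel₀ hn]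
      refine ⟨(‖v‖⁻¹ • v) :: l', isUnitList_cons.2 ⟨h1, hl'⟩, fun w x => ?_⟩
      rw [cliffProd_cons, LinearIsometryEquiv.coe_mul, Function.comp_apply]
      simp only [hs]
      rw [cliff_reflection h1, h, map_smul, List.length_cons, pow_succ, cliffProd_cons]
      simp

/-! ### Pure spinors and products of unit vectors -/

/-- Conjugation by v acts on ℂ¹⁰ as the linear involution ρ, minus the reflection in v, which
identifies the two null spaces. -/
theorem isPure_cliff_iff {v : V} (hv : ‖v‖ = 1) (ψ : S) : IsPure (cliff v ψ) ↔ IsPure ψ := by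
  have hvv : ∑ A, (v A : ℂ) * v A = 1 := by
    have := EuclideanSpace.norm_sq_eq v
    rw [hv] at this
    have h2 : ∑ A, v A * v A = 1 := by
      simpa [sq, eq_comm] using this
    exact_mod_cast h2
  let ρ : (Fin 10 → ℂ) →ₗ[ℂ] (Fin 10 → ℂ) :=
    { toFun := fun z => (2 * ∑ A, z A * v A) • (fun A => (v A : ℂ)) - z
      map_add' := fun z z' => by
        ext A
        simp only [Pi.add_apply, add_mul, Finset.sum_add_distrib, Pi.sub_apply, Pi.smul_apply,
          smul_eq_mul]
        ring
      map_smul' := fun c z => by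
        ext A
        simp only [Pi.smul_apply, smul_eq_mul, Pi.sub_apply, RingHom.id_apply, mul_assoc,
          ← Finset.mul_sum]
        ring }
  have hρ : ∀ z, ρ (ρ z) = z := by
    intro z
    ext A
    have hs : ∑ A, ρ z A * v A = ∑ A, z A * v A := by
      simp only [ρ, LinearMap.coe_mk, AddHom.coe_mk, Pi.sub_apply, Pi.smul_apply, smul_eq_mul,
        sub_mul, mul_assoc, Finset.sum_sub_distrib, ← Finset.mul_sum]
      rw [hvv]
      ring
    change (2 * ∑ A, ρ z A * v A) * (v A : ℂ) - ρ z A = z A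
    rw [hs]
    simp [ρ]
  let e : (Fin 10 → ℂ) ≃ₗ[ℂ] (Fin 10 → ℂ) := LinearEquiv.ofInvolutive ρ hρ
  have hmem : nullSpace (cliff v ψ) = (nullSpace ψ).map (e.symm : (Fin 10 → ℂ) →ₗ[ℂ] _) := by
    rw [← Submodule.comap_equiv_eq_map_symm]
    ext z
    have h1 : cliffC z (cliff v ψ) = cliff v (cliffC (ρ z) ψ) := by
      have h := cliffC_anticomm z (fun A => (v A : ℂ)) ψ
      rw [← eq_sub_iff_add_eq] at h
      change cliffC z (cliffC _ ψ) = cliffC (fun A => (v A : ℂ)) _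
      rw [h]
      simp only [ρ, LinearMap.coe_mk, AddHom.coe_mk, map_sub, map_smul, LinearMap.sub_apply,
        LinearMap.smul_apply]
      congr 1
      rw [show cliffC (fun A => (v A : ℂ)) (cliffC (fun A => (v A : ℂ)) ψ) = ψ from
        cliff_cliff_of_norm_eq_one hv ψ]
    change cliffC z (cliff v ψ) = 0 ↔ cliffC (ρ z) ψ = 0
    rw [h1]
    constructor
    · intro h
      rw [← cliff_cliff_of_norm_eq_one hv (cliffC (ρ z) ψ), h, map_zero]
    · intro h
      rw [h, map_zero]
  rw [IsPure, IsPure, hmem, LinearEquiv.finrank_map_eq]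

theorem IsUnitList.isPure_cliffProd_iff {l : List V} (hl : IsUnitList l) (ψ : S) :
    IsPure (cliffProd l ψ) ↔ IsPure ψ := by
  induction l with
  | nil => rfl
  | cons v l ih =>
    rw [isUnitList_cons] at hl
    rw [cliffProd_cons, isPure_cliff_iff hl.1, ih hl.2]

theorem PurePair.map_cliffProd {Ψ₁ Ψ₂ : S} (h : PurePair Ψ₁ Ψ₂) {l : List V} (hl : IsUnitList l) :
    PurePair (cliffProd l Ψ₁) (cliffProd l Ψ₂) where
  pure_left := (hl.isPure_cliffProd_iff _).2 h.pure_left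
  pure_right := (hl.isPure_cliffProd_iff _).2 h.pure_right
  orthogonal := by
    rw [Orthogonal, R_cliffProd, hl.pairing_cliffProd]
    exact h.orthogonal
  pure_comb a b hab := by
    rw [← map_smul, ← map_smul, ← map_add, hl.isPure_cliffProd_iff]
    exact h.pure_comb a b hab

theorem IsPure.ne_zero {ψ : S} (h : IsPure ψ) : ψ ≠ 0 := by
  rintro rfl
  have : nullSpace 0 = ⊤ := by simp [nullSpace]
  rw [IsPure, this, finrank_top] at h
  simp at h

theorem IsPure.sum_mul_eq_zero {ψ : S} (h : IsPure ψ) {z z' : Fin 10 → ℂ} (hz : z ∈ nullSpace ψ)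
    (hz' : z' ∈ nullSpace ψ) : ∑ A, z A * z' A = 0 := by
  have h1 := cliffC_anticomm z z' ψ
  rw [show cliffC z ψ = 0 from hz, show cliffC z' ψ = 0 from hz', map_zero, map_zero, add_zero] at h1
  have := (smul_eq_zero.1 h1.symm).resolve_right h.ne_zero
  simpa using this

/-- Products of unit vectors act transitively on the lines of pure spinors. -/
theorem IsPure.exists_cliffProd_eq_smul_one {ψ : S} (h : IsPure ψ) :
    ∃ l, IsUnitList l ∧ ∃ c : ℂ, c ≠ 0 ∧ cliffProd l ψ = c • 1 := by
  let N : Submodule ℂ (EuclideanSpace ℂ (Fin 10)) :=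
    (nullSpace ψ).comap (WithLp.linearEquiv 2 ℂ (Fin 10 → ℂ)).toLinearMap
  have hN : Module.finrank ℂ N = 5 := by
    have : N = (nullSpace ψ).map ((WithLp.linearEquiv 2 ℂ (Fin 10 → ℂ)).symm : _ →ₗ[ℂ] _) :=
      Submodule.comap_equiv_eq_map_symm _ _
    rw [this, LinearEquiv.finrank_map_eq]
    exact h
  let m : OrthonormalBasis (Fin 5) ℂ N := (stdOrthonormalBasis ℂ N).reindex (finCongr hN)
  let z : Fin 5 → Fin 10 → ℂ := fun j A => (m j : EuclideanSpace ℂ (Fin 10)) A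
  have hz : ∀ j, z j ∈ nullSpace ψ := fun j => (m j).2
  have hz1 : ∀ j k, ∑ A, conj (z j A) * z k A = if j = k then 1 else 0 := by
    intro j k
    have := orthonormal_iff_ite.1 m.orthonormal j k
    rw [Submodule.coe_inner, PiLp.inner_apply] at this
    rw [← this]
    refine Finset.sum_congr rfl fun A _ => ?_
    rw [RCLike.inner_apply, mul_comm]
  have hz2 : ∀ j k, ∑ A, z j A * z k A = 0 := fun j k => h.sum_mul_eq_zero (hz j) (hz k)
  -- Hermitian orthonormality fixes the sum Re·Re + Im·Im and isotropy the difference; both terms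
  -- equal δ/2, whence the factor √2. The mixed products vanish in the same way.
  let x : Fin 5 → V := fun j => WithLp.toLp 2 fun A => √2 * (z j A).re
  let y : Fin 5 → V := fun j => WithLp.toLp 2 fun A => √2 * (z j A).im
  have h2 : √2 * √2 = (2 : ℝ) := Real.mul_self_sqrt (by norm_num)
  have hre : ∀ j k, (∑ A, (z j A).re * (z k A).re) + (∑ A, (z j A).im * (z k A).im) =
      if j = k then 1 else 0 := by
    intro j k
    have := congrArg Complex.re (hz1 j k)
    rw [Complex.re_sum] at this
    rw [← Finset.sum_add_distrib]
    split_ifs at this ⊢ <;> simpa using this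
  have hre' : ∀ j k, (∑ A, (z j A).re * (z k A).re) - (∑ A, (z j A).im * (z k A).im) = 0 := by
    intro j k
    have := congrArg Complex.re (hz2 j k)
    rw [Complex.re_sum] at this
    rw [← Finset.sum_sub_distrib]
    simpa using this
  have him : ∀ j k, (∑ A, (z j A).re * (z k A).im) - (∑ A, (z j A).im * (z k A).re) = 0 := by
    intro j k
    have := congrArg Complex.im (hz1 j k)
    rw [Complex.im_sum] at this
    rw [← Finset.sum_sub_distrib]
    split_ifs at this <;> simpa [sub_eq_add_neg] using this
  have him' : ∀ j k, (∑ A, (z j A).re * (z k A).im) + (∑ A, (z j A).im * (z k A).re) = 0 := by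
    intro j k
    have := congrArg Complex.im (hz2 j k)
    rw [Complex.im_sum] at this
    rw [← Finset.sum_add_distrib]
    simpa using this
  have hinner : ∀ a b : Fin 10 → ℝ, inner ℝ (WithLp.toLp 2 (fun A => √2 * a A) : V)
      (WithLp.toLp 2 (fun A => √2 * b A)) = 2 * ∑ A, a A * b A := by
    intro a b
    rw [PiLp.inner_apply, Finset.mul_sum]
    refine Finset.sum_congr rfl fun A _ => ?_
    simp only [RCLike.inner_apply, conj_trivial]
    linear_combination (a A * b A) * h2
  have hon : Orthonormal ℝ (Fin.append x y) := by
    rw [orthonormal_iff_ite]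
    intro A B
    refine Fin.addCases (fun j => ?_) (fun j => ?_) A <;>
      refine Fin.addCases (fun k => ?_) (fun k => ?_) B
    · rw [Fin.append_left, Fin.append_left, hinner]
      simp only [Fin.castAdd_inj]
      linear_combination hre j k + hre' j k
    · rw [Fin.append_left, Fin.append_right, hinner]
      rw [if_neg (by simp [Fin.ext_iff]; omega)]
      linear_combination him j k + him' j k
    · rw [Fin.append_left, Fin.append_right, hinner]
      rw [if_neg (by simp [Fin.ext_iff]; omega)]
      linear_combination him' j k - him j k
    · rw [Fin.append_right, Fin.append_right, hinner]
      simp only [Fin.natAdd_inj]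
      linear_combination hre j k - hre' j k
  let b : OrthonormalBasis (Fin 10) ℝ V := OrthonormalBasis.mk hon (by
    have : LinearIndependent ℝ (Fin.append x y) := hon.linearIndependent
    rw [this.span_eq_top_of_card_eq_finrank' (by simp)])
  have hb : ⇑b = Fin.append x y := OrthonormalBasis.coe_mk _ _
  obtain ⟨l, hl, hlf⟩ := exists_unitList b.repr
  refine ⟨l, hl, scalarPart (cliffProd l ψ), ?_⟩
  have hkill : cliffProd l ψ = scalarPart (cliffProd l ψ) • 1 := by
    rw [← Algebra.algebraMap_eq_smul_one]
    refine eq_algebraMap_of_contract_eq_zero fun u => ?_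
    have hj : ∀ j, contract (covector (Pi.single j 1)) (cliffProd l ψ) = 0 := by
      intro j
      have h1 : b.repr (x j) = EuclideanSpace.single (Fin.castAdd 5 j : Fin (5 + 5)) 1 := by
        rw [← b.repr_self, hb, Fin.append_left]
      have h2 : b.repr (y j) = EuclideanSpace.single (Fin.natAdd 5 j : Fin (5 + 5)) 1 := by
        rw [← b.repr_self, hb, Fin.append_right]
      have h3 := hlf (x j) ψ
      have h4 := hlf (y j) ψ
      have h5 : cliff (x j) ψ + Complex.I • cliff (y j) ψ = 0 := by
        have h6 : x j = √2 • WithLp.toLp 2 (fun A => (z j A).re) := by ext A; simp [x]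
        have h7 : y j = √2 • WithLp.toLp 2 (fun A => (z j A).im) := by ext A; simp [y]
        have h8 : cliffC (z j) ψ = 0 := hz j
        rw [cliffC_eq_cliff] at h8
        rw [h6, h7, map_smul, map_smul, LinearMap.smul_apply, LinearMap.smul_apply,
          smul_comm Complex.I, ← smul_add, h8, smul_zero]
      have h9 : cliff (EuclideanSpace.single (Fin.castAdd 5 j : Fin (5 + 5)) 1) (cliffProd l ψ) +
          Complex.I • cliff (EuclideanSpace.single (Fin.natAdd 5 j : Fin (5 + 5)) 1)
            (cliffProd l ψ) = 0 := by
        rw [← h1, ← h2, h3, h4, smul_comm Complex.I, ← smul_add, ← map_smul (cliffProd l),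
          ← map_add, h5, map_zero, smul_zero]
      rw [cliff_single, cliff_single] at h9
      rw [Gam, Fin.append_left, Fin.append_right] at h9
      -- The null vector of index j has become the sum of a generator i (a - a†) and i times its
      -- partner a + a†, which is 2i a.
      have h11 : (2 * Complex.I) • annihilate j (cliffProd l ψ) = 0 := by
        rw [← h9]
        simp only [LinearMap.smul_apply, LinearMap.sub_apply, LinearMap.add_apply]
        module
      rw [covector_single]
      exact (smul_eq_zero.1 h11).resolve_left (by simp)
    have hu : covector u = ∑ j, u j • covector (Pi.single j 1) := by
      rw [covector_eq_sum]; simp only [covector_single]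
    rw [hu]
    rw [contract, map_sum, LinearMap.sum_apply]
    refine Finset.sum_eq_zero fun j _ => ?_
    rw [map_smul, LinearMap.smul_apply]
    exact (congrArg _ (hj j)).trans (smul_zero _)
  refine ⟨fun h0 => h.ne_zero ?_, hkill⟩
  rw [← hl.cliffProd_reverse_cliffProd ψ, hkill, h0, zero_smul, map_zero]

/-! ### Unitary transformations of the basic one-forms -/

/-- The action of a `5 × 5` matrix on polyforms. -/
abbrev matrixMap (A : Matrix (Fin 5) (Fin 5) ℂ) : S →ₐ[ℂ] S :=
  ExteriorAlgebra.map (Matrix.toLin' A)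

theorem su5Rep_apply (U : Matrix.specialUnitaryGroup (Fin 5) ℂ) (x : S) :
    su5Rep U x = matrixMap U x := rfl

theorem matrixMap_ι (A : Matrix (Fin 5) (Fin 5) ℂ) (w : Fin 5 → ℂ) :
    matrixMap A (ExteriorAlgebra.ι ℂ w) = ExteriorAlgebra.ι ℂ (A.mulVec w) := by
  rw [matrixMap, ExteriorAlgebra.map_apply_ι, Matrix.toLin'_apply]

theorem matrixMap_e (A : Matrix (Fin 5) (Fin 5) ℂ) (j : Fin 5) :
    matrixMap A (e j) = ExteriorAlgebra.ι ℂ (A.col j) := by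
  rw [e, matrixMap_ι, Matrix.mulVec_single_one]

theorem covector_eq_dotProduct (u w : Fin 5 → ℂ) : covector u w = u ⬝ᵥ w := covector_apply u w

theorem covector_star_mulVec {A : Matrix (Fin 5) (Fin 5) ℂ}
    (hA : A ∈ Matrix.unitaryGroup (Fin 5) ℂ) (w v : Fin 5 → ℂ) :
    covector (star (A.mulVec w)) (A.mulVec v) = covector (star w) v := by
  rw [covector_eq_dotProduct, covector_eq_dotProduct, Matrix.star_mulVec, ← Matrix.dotProduct_mulVec,
    Matrix.mulVec_mulVec, ← Matrix.star_eq_conjTranspose, Matrix.mem_unitaryGroup_iff'.1 hA,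
    Matrix.one_mulVec]

/-- Unitarity enters here: A preserves the Hermitian product, hence carries the covector conjugate
to w to the one conjugate to A w. -/
theorem matrixMap_contract {A : Matrix (Fin 5) (Fin 5) ℂ}
    (hA : A ∈ Matrix.unitaryGroup (Fin 5) ℂ) (w : Fin 5 → ℂ) (x : S) :
    matrixMap A (contract (covector (star w)) x) =
      contract (covector (star (A.mulVec w))) (matrixMap A x) := by
  induction x using polyform_induction with
  | algebraMap r =>
    rw [contract_algebraMap, AlgHom.commutes, contract_algebraMap, map_zero]
  | add x y hx hy => rw [map_add, map_add, hx, hy, map_add, map_add]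
  | ι_mul v x hx =>
    rw [contract_ι_mul, map_sub, map_smul, map_mul, map_mul, matrixMap_ι, contract_ι_mul, hx,
      covector_star_mulVec hA]

theorem norm_sq_eq_covector (v : V) :
    ((‖v‖ ^ 2 : ℝ) : ℂ) = covector (star (toComplex v)) (toComplex v) := by
  rw [← norm_sq_toComplex, covector_apply]
  push_cast
  refine Finset.sum_congr rfl fun j _ => ?_
  rw [Pi.star_apply, RCLike.star_def, Complex.conj_mul']

/-- The isometry of `ℝ¹⁰` given by a unitary matrix. -/
def unitaryIsometry (A : Matrix (Fin 5) (Fin 5) ℂ) (hA : A ∈ Matrix.unitaryGroup (Fin 5) ℂ) :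
    V ≃ₗᵢ[ℝ] V :=
  LinearIsometry.toLinearIsometryEquiv
    { toLinearMap := (toComplex.symm : (Fin 5 → ℂ) →ₗ[ℝ] V) ∘ₗ
        ((Matrix.toLin' A).restrictScalars ℝ) ∘ₗ (toComplex : V →ₗ[ℝ] (Fin 5 → ℂ))
      norm_map' := fun v => by
        rw [← sq_eq_sq₀ (norm_nonneg _) (norm_nonneg _)]
        have h : ∀ v w : V, toComplex v = A.mulVec (toComplex w) → ‖v‖ ^ 2 = ‖w‖ ^ 2 := by
          intro v w h
          have h1 := norm_sq_eq_covector v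
          rw [h, covector_star_mulVec hA, ← norm_sq_eq_covector] at h1
          exact_mod_cast h1
        refine h _ _ ?_
        simp } rfl

theorem toComplex_unitaryIsometry (A : Matrix (Fin 5) (Fin 5) ℂ)
    (hA : A ∈ Matrix.unitaryGroup (Fin 5) ℂ) (v : V) :
    toComplex (unitaryIsometry A hA v) = A.mulVec (toComplex v) := by
  simp [unitaryIsometry]

theorem matrixMap_cliff {A : Matrix (Fin 5) (Fin 5) ℂ}
    (hA : A ∈ Matrix.unitaryGroup (Fin 5) ℂ) (v : V) (x : S) :
    matrixMap A (cliff v x) = cliff (unitaryIsometry A hA v) (matrixMap A x) := by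
  rw [cliff_eq, cliff_eq, map_add, matrixMap_contract hA, map_mul, matrixMap_ι,
    toComplex_unitaryIsometry]

theorem matrixMap_volume (A : Matrix (Fin 5) (Fin 5) ℂ) : top (matrixMap A volume) = A.det := by
  rw [volume, matrixMap, ExteriorAlgebra.map_apply_ιMulti, top_ιMulti_five, ← Matrix.det_transpose]
  congr 1
  ext i j
  simp

theorem pairing_one (x : S) : pairing 1 x = top x := by
  rw [pairing, CliffordAlgebra.reverse.map_one, one_mul]

/-- An operator which commutes with Clifford multiplication is a scalar. -/
theorem eq_smul_of_commute_cliff {T : Module.End ℂ S}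
    (h : ∀ v x, T (cliff v x) = cliff v (T x)) (x : S) : T x = scalarPart (T 1) • x := by
  have hC : ∀ z x, T (cliffC z x) = cliffC z (T x) := by
    intro z x
    rw [cliffC_eq_cliff, cliffC_eq_cliff, map_add, map_smul, h, h]
  have hι : ∀ w x, T (ExteriorAlgebra.ι ℂ w * x) = ExteriorAlgebra.ι ℂ w * T x := by
    intro w x
    have := hC (lightcone 0 w) x
    simpa [cliffC_lightcone] using this
  have hc : ∀ u x, T (contract (covector u) x) = contract (covector u) (T x) := by
    intro w x
    have := hC (lightcone w 0) x
    simpa [cliffC_lightcone] using this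
  have h1 : T 1 = algebraMap ℂ S (scalarPart (T 1)) :=
    eq_algebraMap_of_contract_eq_zero fun u => by rw [← hc, contract_one, map_zero]
  induction x using polyform_induction with
  | algebraMap r =>
    rw [Algebra.algebraMap_eq_smul_one, map_smul, smul_comm, ← Algebra.algebraMap_eq_smul_one
      (scalarPart (T 1)), ← h1]
  | add x y hx hy => rw [map_add, hx, hy, smul_add]
  | ι_mul v x hx => rw [hι, hx, mul_smul_comm]

theorem exists_cliffProd_eq_neg : ∃ l, IsUnitList l ∧ Even l.length ∧ ∀ x, cliffProd l x = - x := by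
  have h1 : ‖(EuclideanSpace.single (0 : Fin 10) (1 : ℝ))‖ = 1 := by simp
  refine ⟨[EuclideanSpace.single 0 1, -EuclideanSpace.single 0 1], ?_, by decide, fun x => ?_⟩
  · intro v hv
    simp only [List.mem_cons, List.not_mem_nil, or_false] at hv
    rcases hv with rfl | rfl
    · exact h1
    · rw [norm_neg, h1]
  · rw [cliffProd_cons, cliffProd_cons, cliffProd_nil, map_neg, LinearMap.neg_apply, map_neg,
      cliff_cliff_of_norm_eq_one h1]

/-- The action of `SU(5)` on polyforms is by products of an even number of unit vectors. -/
theorem exists_cliffProd_eq_su5Rep (U : Matrix.specialUnitaryGroup (Fin 5) ℂ) :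
    ∃ l, IsUnitList l ∧ Even l.length ∧ cliffProd l = su5Rep U := by
  obtain ⟨hU, hdet⟩ := Matrix.mem_specialUnitaryGroup_iff.1 U.2
  obtain ⟨l, hl, h⟩ := exists_unitList (unitaryIsometry (U : Matrix (Fin 5) (Fin 5) ℂ) hU)
  -- Both factors implement the same isometry of ℝ¹⁰, so T commutes with vectors up to the sign
  -- (-1)^length.
  let T : Module.End ℂ S := cliffProd l.reverse * su5Rep U
  have hG : ∀ x, cliffProd l (T x) = su5Rep U x := fun x => hl.cliffProd_cliffProd_reverse _
  have hT : ∀ v x, T (cliff v x) = (-1 : ℂ) ^ l.length • cliff v (T x) := by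
    intro v x
    have h1 := h v (T x)
    rw [hG] at h1
    change cliffProd l.reverse (matrixMap _ (cliff v x)) = _
    rw [matrixMap_cliff hU]
    change cliffProd l.reverse (cliff _ (su5Rep U x)) = _
    rw [h1, map_smul, hl.cliffProd_reverse_cliffProd]
  have hone : su5Rep U 1 = 1 := map_one (matrixMap U)
  -- For odd length T 1 would still be a scalar, and an odd product applied to it would give the
  -- even spinor 1.
  have heven : Even l.length := by
    by_contra hodd
    rw [Nat.not_even_iff_odd] at hodd
    rw [hodd.neg_one_pow] at hT
    have h1 : T 1 = algebraMap ℂ S (scalarPart (T 1)) := by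
      have hC : ∀ z x, T (cliffC z x) = - cliffC z (T x) := by
        intro z x
        rw [cliffC_eq_cliff, cliffC_eq_cliff, map_add, map_smul, hT, hT]
        module
      refine eq_algebraMap_of_contract_eq_zero fun u => ?_
      have := hC (lightcone u 0) 1
      simpa [cliffC_lightcone, contract_one] using this
    have h2 := parity_cliffProd l (T 1)
    rw [hG, hone, h1, AlgHom.commutes, ← h1, hG, hone, hodd.neg_one_pow, map_one] at h2
    have h3 : (2 : ℂ) • (1 : S) = 0 := by
      rw [two_smul]; nth_rw 1 [h2]; simp
    rcases smul_eq_zero.1 h3 with h3 | h3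
    · exact two_ne_zero h3
    · exact one_ne_zero h3
  rw [heven.neg_one_pow] at hT
  simp only [one_smul] at hT
  have hs := eq_smul_of_commute_cliff hT
  set c := scalarPart (T 1)
  have hL : ∀ x, su5Rep U x = c • cliffProd l x := by
    intro x
    rw [← hG, hs, map_smul]
  -- Both operators preserve the pairing of 1 with the volume form, U because its determinant is 1.
  -- A remaining sign -1 is itself an even product of unit vectors.
  have hc : c * c = 1 := by
    have h1 : pairing (su5Rep U 1) (su5Rep U volume) = 1 := by
      rw [hone, pairing_one]
      exact (matrixMap_volume U).trans hdet
    rw [hL, hL, pairing_smul_left, pairing_smul_right, hl.pairing_cliffProd, pairing_one,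
      top_volume, mul_one] at h1
    exact h1
  rcases mul_self_eq_one_iff.1 hc with hc | hc
  · refine ⟨l, hl, heven, ?_⟩
    refine LinearMap.ext fun x => ?_
    rw [hL, hc, one_smul]
  · obtain ⟨l', hl', heven', hneg⟩ := exists_cliffProd_eq_neg
    refine ⟨l' ++ l, hl'.append hl, ?_, ?_⟩
    · rw [List.length_append]; exact heven'.add heven
    · refine LinearMap.ext fun x => ?_
      rw [cliffProd_append, hneg, hL, hc, neg_one_smul]

/-! ### The normal form of a pair -/

theorem exists_su5_mulVec {w u : EuclideanSpace ℂ (Fin 5)} (hw : ‖w‖ = 1) (hu : ‖u‖ = 1)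
    (hwu : inner ℂ w u = 0) : ∃ U : Matrix.specialUnitaryGroup (Fin 5) ℂ,
      (U : Matrix (Fin 5) (Fin 5) ℂ).mulVec w = Pi.single 3 1 ∧
      (U : Matrix (Fin 5) (Fin 5) ℂ).mulVec u = Pi.single 4 1 := by
  -- The zeros are placeholders: only slots 3 and 4 are retained when extending to an orthonormal
  -- basis.
  let v : Fin 5 → EuclideanSpace ℂ (Fin 5) := ![0, 0, 0, w, u]
  have huw : inner ℂ u w = 0 := by rw [← inner_conj_symm, hwu, map_zero]
  have hv : Orthonormal ℂ (Set.domRestrict {3, 4} v) := by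
    rw [orthonormal_iff_ite]
    rintro ⟨i, hi⟩ ⟨j, hj⟩
    rcases hi with rfl | rfl <;> rcases hj with rfl | rfl
    · simp [v, inner_self_eq_norm_sq_to_K, hw]
    · simp only [Set.domRestrict_apply, v]
      rw [if_neg fun h => absurd (congrArg Subtype.val h) (by decide)]
      exact hwu
    · simp only [Set.domRestrict_apply, v]
      rw [if_neg fun h => absurd (congrArg Subtype.val h) (by decide)]
      exact huw
    · simp [v, inner_self_eq_norm_sq_to_K, hu]
  obtain ⟨b, hb⟩ := hv.exists_orthonormalBasis_extension_of_card_eq (by simp)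
  have hb3 : b 3 = w := hb 3 (by simp)
  have hb4 : b 4 = u := hb 4 (by simp)
  let A : Matrix (Fin 5) (Fin 5) ℂ := Matrix.of fun i k => conj (b i k)
  have hAb : ∀ x : EuclideanSpace ℂ (Fin 5), ∀ i, A.mulVec x i = inner ℂ (b i) x := by
    intro x i
    rw [PiLp.inner_apply, Matrix.mulVec, dotProduct]
    refine Finset.sum_congr rfl fun k _ => ?_
    rw [RCLike.inner_apply, mul_comm]
    rfl
  have hA : A ∈ Matrix.unitaryGroup (Fin 5) ℂ := by
    rw [Matrix.mem_unitaryGroup_iff]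
    ext i j
    have h1 := orthonormal_iff_ite.1 b.orthonormal i j
    rw [← hAb] at h1
    rw [Matrix.one_apply, ← h1, Matrix.mul_apply, Matrix.mulVec, dotProduct]
    refine Finset.sum_congr rfl fun k _ => ?_
    simp [A, Matrix.star_apply]
  -- The determinant is corrected by a phase in slot 0, away from the two prescribed vectors.
  let D : Matrix (Fin 5) (Fin 5) ℂ := Matrix.diagonal ![star A.det, 1, 1, 1, 1]
  have hdet : A.det * star A.det = 1 := (Unitary.mem_iff.1 (Matrix.det_of_mem_unitary hA)).2
  have hD : D ∈ Matrix.unitaryGroup (Fin 5) ℂ := by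
    rw [Matrix.mem_unitaryGroup_iff, Matrix.star_eq_conjTranspose, Matrix.diagonal_conjTranspose,
      Matrix.diagonal_mul_diagonal, ← Matrix.diagonal_one]
    congr 1
    ext i
    fin_cases i <;> simp
    rw [mul_comm]
    exact hdet
  refine ⟨⟨D * A, Matrix.mem_specialUnitaryGroup_iff.2 ⟨mul_mem hD hA, ?_⟩⟩, ?_, ?_⟩
  · rw [Matrix.det_mul, Matrix.det_diagonal, Fin.prod_univ_five]
    change star A.det * 1 * 1 * 1 * 1 * A.det = 1
    simp only [mul_one]
    rw [mul_comm]
    exact hdet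
  · change (D * A).mulVec w = _
    ext i
    rw [← Matrix.mulVec_mulVec, Matrix.mulVec_diagonal, hAb, ← hb3,
      orthonormal_iff_ite.1 b.orthonormal]
    fin_cases i <;> simp
  · change (D * A).mulVec u = _
    ext i
    rw [← Matrix.mulVec_mulVec, Matrix.mulVec_diagonal, hAb, ← hb4,
      orthonormal_iff_ite.1 b.orthonormal]
    fin_cases i <;> simp

/-- Gram–Schmidt: subtracting from u its component along w does not change w ∧ u. -/
theorem exists_su5Rep_ι_mul_ι {w u : Fin 5 → ℂ}
    (h : ExteriorAlgebra.ι ℂ w * ExteriorAlgebra.ι ℂ u ≠ 0) :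
    ∃ U : Matrix.specialUnitaryGroup (Fin 5) ℂ, ∃ c : ℂ, c ≠ 0 ∧
      su5Rep U (ExteriorAlgebra.ι ℂ w * ExteriorAlgebra.ι ℂ u) = c • (e 3 * e 4) := by
  let w' : EuclideanSpace ℂ (Fin 5) := WithLp.toLp 2 w
  let u' : EuclideanSpace ℂ (Fin 5) := WithLp.toLp 2 u
  have hw : w' ≠ 0 := by
    intro hw
    apply h
    have : w = 0 := congrArg WithLp.ofLp hw
    rw [this, map_zero, zero_mul]
  let t : ℂ := inner ℂ w' u' / inner ℂ w' w'
  let u₁ : EuclideanSpace ℂ (Fin 5) := u' - t • w'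
  have hι : ExteriorAlgebra.ι ℂ w * ExteriorAlgebra.ι ℂ u =
      ExteriorAlgebra.ι ℂ w * ExteriorAlgebra.ι ℂ (WithLp.ofLp u₁) := by
    have : WithLp.ofLp u₁ = u - t • w := rfl
    rw [this, map_sub, map_smul, mul_sub, mul_smul_comm, ExteriorAlgebra.ι_sq_zero, smul_zero,
      sub_zero]
  have hu₁ : u₁ ≠ 0 := by
    intro hu
    apply h
    rw [hι, hu]
    simp
  have horth : inner ℂ w' u₁ = 0 := by
    rw [inner_sub_right, inner_smul_right, div_mul_cancel₀ _ (inner_self_ne_zero.2 hw), sub_self]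
  have hnw : (‖w'‖ : ℂ) ≠ 0 := by exact_mod_cast norm_ne_zero_iff.2 hw
  have hnu : (‖u₁‖ : ℂ) ≠ 0 := by exact_mod_cast norm_ne_zero_iff.2 hu₁
  obtain ⟨U, hU3, hU4⟩ := exists_su5_mulVec (w := (‖w'‖ : ℂ)⁻¹ • w') (u := (‖u₁‖ : ℂ)⁻¹ • u₁)
    (norm_smul_inv_norm hw) (norm_smul_inv_norm hu₁)
    (by rw [inner_smul_left, inner_smul_right, horth, mul_zero, mul_zero])
  refine ⟨U, (‖w'‖ : ℂ) * ‖u₁‖, mul_ne_zero hnw hnu, ?_⟩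
  have h3 : (U : Matrix (Fin 5) (Fin 5) ℂ).mulVec w = (‖w'‖ : ℂ) • Pi.single 3 1 := by
    rw [← hU3, ← Matrix.mulVec_smul]
    congr 1
    rw [WithLp.ofLp_smul, smul_smul, mul_inv_cancel₀ hnw, one_smul]
  have h4 : (U : Matrix (Fin 5) (Fin 5) ℂ).mulVec (WithLp.ofLp u₁) =
      (‖u₁‖ : ℂ) • Pi.single 4 1 := by
    rw [← hU4, ← Matrix.mulVec_smul]
    congr 1
    rw [WithLp.ofLp_smul, smul_smul, mul_inv_cancel₀ hnu, one_smul]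
  rw [hι]
  rw [su5Rep_apply, map_mul, matrixMap_ι, matrixMap_ι, h3, h4, map_smul, map_smul, smul_mul_smul_comm]
  rfl

theorem PurePair.exists_eq_ι_mul_ι {c : ℂ} {φ : S} (h : PurePair (c • 1) φ) :
    ∃ w u, φ = ExteriorAlgebra.ι ℂ w * ExteriorAlgebra.ι ℂ u := by
  have hc : c ≠ 0 := by
    rintro rfl
    exact h.pure_left.ne_zero (zero_smul _ _)
  have h0 : scalarPart φ = 0 := (orthogonal_smul_one_iff hc φ).1 h.orthogonal
  have hp := h.pure_comb c⁻¹ c⁻¹ (by simp [hc])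
  have hm := h.pure_comb c⁻¹ (-c⁻¹) (by simp [hc])
  rw [smul_smul, inv_mul_cancel₀ hc, one_smul] at hp hm
  rw [neg_smul, ← sub_eq_add_neg] at hm
  obtain ⟨w, u, hwu⟩ := SpinTen.exists_eq_ι_mul_ι (by rw [map_smul, h0, smul_zero])
    (smul_ne_zero (inv_ne_zero hc) h.pure_right.ne_zero) hp hm
  refine ⟨c • w, u, ?_⟩
  rw [map_smul, smul_mul_assoc, ← hwu, smul_smul, mul_inv_cancel₀ hc, one_smul]

/-- Up to products of unit vectors, a pair consists of multiples of `1` and `e₄ ∧ e₅`. -/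
theorem PurePair.exists_cliffProd {Ψ₁ Ψ₂ : S} (h : PurePair Ψ₁ Ψ₂) :
    ∃ l, IsUnitList l ∧ ∃ c c' : ℂ, c ≠ 0 ∧ c' ≠ 0 ∧ cliffProd l Ψ₁ = c • 1 ∧
      cliffProd l Ψ₂ = c' • (e 3 * e 4) := by
  obtain ⟨l, hl, c, hc, h1⟩ := h.pure_left.exists_cliffProd_eq_smul_one
  have h' := h.map_cliffProd hl
  rw [h1] at h'
  obtain ⟨w, u, hwu⟩ := h'.exists_eq_ι_mul_ι
  obtain ⟨U, c', hc', hU⟩ := exists_su5Rep_ι_mul_ι (w := w) (u := u) (by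
    rw [← hwu]; exact h'.pure_right.ne_zero)
  obtain ⟨l', hl', -, hl'U⟩ := exists_cliffProd_eq_su5Rep U
  refine ⟨l' ++ l, hl'.append hl, c, c', hc, hc', ?_, ?_⟩
  · rw [cliffProd_append, h1, map_smul, hl'U]
    exact congrArg _ (map_one (matrixMap U))
  · rw [cliffProd_append, hwu, hl'U, hU]

/-! ### Block diagonal matrices in `SU(5)` -/

theorem smMatrix_castAdd_natAdd (x : SM) (i : Fin 3) (j : Fin 2) :
    smMatrix x (Fin.castAdd 2 i) (Fin.natAdd 3 j) = 0 := by
  rw [smMatrix, Matrix.reindex_apply, Matrix.submatrix_apply, finSumFinEquiv_symm_apply_castAdd,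
    finSumFinEquiv_symm_apply_natAdd, Matrix.fromBlocks_apply₁₂]
  rfl

theorem smMatrix_natAdd_natAdd (x : SM) (i j : Fin 2) :
    smMatrix x (Fin.natAdd 3 i) (Fin.natAdd 3 j) =
      ((x.2.2 ^ (3 : ℤ) : Circle) : ℂ) * (x.2.1 : Matrix (Fin 2) (Fin 2) ℂ) i j := by
  rw [smMatrix, Matrix.reindex_apply, Matrix.submatrix_apply, finSumFinEquiv_symm_apply_natAdd,
    finSumFinEquiv_symm_apply_natAdd, Matrix.fromBlocks_apply₂₂]
  rfl

theorem smRep_apply (x : SM) (ψ : S) : smRep x ψ = matrixMap (smMatrix x) ψ := rfl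

theorem smRep_one (x : SM) : smRep x 1 = 1 := map_one (matrixMap (smMatrix x))

theorem e_mul_e_swap : e 4 * e 3 = - (e 3 * e 4) :=
  eq_neg_of_add_eq_zero_left (ExteriorAlgebra.ι_add_mul_swap _ _)

theorem e_mul_self (j : Fin 5) : e j * e j = 0 := ExteriorAlgebra.ι_sq_zero _

/-- The action on the top power of ℂ² is the determinant of the lower block, (α³)² det h₂ = α⁶. -/
theorem smRep_e_mul_e (x : SM) :
    smRep x (e 3 * e 4) = ((x.2.2 ^ (6 : ℤ) : Circle) : ℂ) • (e 3 * e 4) := by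
  have hdet := (Matrix.mem_specialUnitaryGroup_iff.1 x.2.1.2).2
  rw [Matrix.det_fin_two] at hdet
  have h1 : ∀ (i : Fin 3) (j : Fin 2), (smMatrix x).col (Fin.natAdd 3 j) (Fin.castAdd 2 i) = 0 :=
    fun i j => smMatrix_castAdd_natAdd x i j
  have hcol : ∀ j : Fin 2, ExteriorAlgebra.ι ℂ ((smMatrix x).col (Fin.natAdd 3 j)) =
      smMatrix x (Fin.natAdd 3 (0 : Fin 2)) (Fin.natAdd 3 j) • e 3 +
      smMatrix x (Fin.natAdd 3 (1 : Fin 2)) (Fin.natAdd 3 j) • e 4 := by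
    intro j
    rw [ι_eq_sum, Fin.sum_univ_five]
    rw [show (smMatrix x).col (Fin.natAdd 3 j) 0 = 0 from h1 0 j,
      show (smMatrix x).col (Fin.natAdd 3 j) 1 = 0 from h1 1 j,
      show (smMatrix x).col (Fin.natAdd 3 j) 2 = 0 from h1 2 j]
    simp only [zero_smul, zero_add]
    rfl
  have h3 : matrixMap (smMatrix x) (e 3) = _ := (matrixMap_e (smMatrix x) 3).trans (hcol 0)
  have h4 : matrixMap (smMatrix x) (e 4) = _ := (matrixMap_e (smMatrix x) 4).trans (hcol 1)
  have h6 : ((x.2.2 ^ (6 : ℤ) : Circle) : ℂ) =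
      ((x.2.2 ^ (3 : ℤ) : Circle) : ℂ) * ((x.2.2 ^ (3 : ℤ) : Circle) : ℂ) := by
    rw [← Circle.coe_mul, ← zpow_add]; rfl
  rw [smRep_apply, map_mul, h3, h4]
  simp only [smMatrix_natAdd_natAdd, add_mul, mul_add, smul_mul_assoc, mul_smul_comm, e_mul_self,
    e_mul_e_swap, smul_zero, zero_add, add_zero, smul_neg, smul_smul]
  rw [← neg_smul, ← add_smul, h6]
  congr 1
  linear_combination ((x.2.2 ^ (3 : ℤ) : Circle) : ℂ) * ((x.2.2 ^ (3 : ℤ) : Circle) : ℂ) * hdet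

/-- The block diagonal matrices in `SU(5)` are in the image of `SU(3) × SU(2) × U(1)`. -/
theorem exists_smMatrix_eq {A : Matrix (Fin 5) (Fin 5) ℂ}
    (hA : A ∈ Matrix.specialUnitaryGroup (Fin 5) ℂ)
    (h12 : ∀ (i : Fin 3) (j : Fin 2), A (Fin.castAdd 2 i) (Fin.natAdd 3 j) = 0)
    (h21 : ∀ (i : Fin 2) (j : Fin 3), A (Fin.natAdd 3 i) (Fin.castAdd 2 j) = 0) :
    ∃ x : SM, smMatrix x = A := by
  obtain ⟨hU, hdet⟩ := Matrix.mem_specialUnitaryGroup_iff.1 hA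
  let B : Matrix (Fin 3) (Fin 3) ℂ := A.submatrix (Fin.castAdd 2) (Fin.castAdd 2)
  let C : Matrix (Fin 2) (Fin 2) ℂ := A.submatrix (Fin.natAdd 3) (Fin.natAdd 3)
  have hblock : A = Matrix.reindex (finSumFinEquiv (m := 3) (n := 2))
      (finSumFinEquiv (m := 3) (n := 2)) (Matrix.fromBlocks B 0 0 C) := by
    ext i j
    rw [Matrix.reindex_apply, Matrix.submatrix_apply]
    change Fin (3 + 2) at i
    change Fin (3 + 2) at j
    refine Fin.addCases (fun i => ?_) (fun i => ?_) i <;>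
      refine Fin.addCases (fun j => ?_) (fun j => ?_) j
    · rw [finSumFinEquiv_symm_apply_castAdd, finSumFinEquiv_symm_apply_castAdd]; rfl
    · rw [finSumFinEquiv_symm_apply_castAdd, finSumFinEquiv_symm_apply_natAdd, h12]; rfl
    · rw [finSumFinEquiv_symm_apply_castAdd, finSumFinEquiv_symm_apply_natAdd, h21]; rfl
    · rw [finSumFinEquiv_symm_apply_natAdd, finSumFinEquiv_symm_apply_natAdd]; rfl
  have hmul := Matrix.mem_unitaryGroup_iff.1 hU
  rw [hblock, Matrix.star_eq_conjTranspose, Matrix.conjTranspose_reindex, Matrix.reindex_apply,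
    Matrix.reindex_apply, Matrix.submatrix_mul_equiv, Matrix.fromBlocks_conjTranspose,
    Matrix.fromBlocks_multiply] at hmul
  have hmul2 := congrArg (Matrix.reindex (finSumFinEquiv (m := 3) (n := 2)).symm
    (finSumFinEquiv (m := 3) (n := 2)).symm) hmul
  simp only [Matrix.reindex_apply, Matrix.submatrix_submatrix, Equiv.symm_symm,
    Equiv.symm_comp_self, Matrix.submatrix_id_id, Matrix.submatrix_one_equiv] at hmul2
  rw [← Matrix.fromBlocks_one, Matrix.fromBlocks_inj] at hmul2
  obtain ⟨hB, -, -, hC⟩ := hmul2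
  simp only [Matrix.conjTranspose_zero, Matrix.mul_zero, add_zero, zero_add] at hB hC
  have hBU : B ∈ Matrix.unitaryGroup (Fin 3) ℂ := Matrix.mem_unitaryGroup_iff.2 hB
  have hCU : C ∈ Matrix.unitaryGroup (Fin 2) ℂ := Matrix.mem_unitaryGroup_iff.2 hC
  rw [hblock, Matrix.det_reindex_self, Matrix.det_fromBlocks_zero₂₁] at hdet
  have hCn : ‖C.det‖ = 1 := CStarRing.norm_of_mem_unitary (Matrix.det_of_mem_unitary hCU)
  let θ := C.det.arg
  -- A sixth root of det C makes both α² B and α⁻³ C of determinant 1, the former because det B ·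
  -- det C = 1.
  let α : Circle := Circle.exp (θ / 6)
  have hα : ((α ^ (6 : ℤ) : Circle) : ℂ) = C.det := by
    rw [show (6 : ℤ) = ((6 : ℕ) : ℤ) from rfl, zpow_natCast, ← Circle.exp_natCast_mul,
      Circle.coe_exp]
    conv_rhs => rw [← Complex.norm_mul_exp_arg_mul_I C.det, hCn]
    push_cast
    rw [one_mul]
    congr 1
    ring
  have hsmul : ∀ {n : ℕ} (β : Circle) {M : Matrix (Fin n) (Fin n) ℂ},
      M ∈ Matrix.unitaryGroup (Fin n) ℂ → (β : ℂ) • M ∈ Matrix.unitaryGroup (Fin n) ℂ := by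
    intro n β M hM
    rw [Matrix.mem_unitaryGroup_iff] at hM ⊢
    rw [star_smul, smul_mul_smul_comm, hM, Complex.star_def, ← Circle.coe_inv_eq_conj,
      ← Circle.coe_mul, mul_inv_cancel, Circle.coe_one, one_smul]
  refine ⟨⟨⟨((α ^ (2 : ℤ) : Circle) : ℂ) • B, ?_⟩, ⟨((α ^ (-3 : ℤ) : Circle) : ℂ) • C, ?_⟩, α⟩, ?_⟩
  · refine Matrix.mem_specialUnitaryGroup_iff.2 ⟨hsmul _ hBU, ?_⟩
    rw [Matrix.det_smul, Fintype.card_fin, ← Circle.coe_pow, ← zpow_natCast, ← zpow_mul]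
    change ((α ^ (6 : ℤ) : Circle) : ℂ) * B.det = 1
    rw [hα, mul_comm, hdet]
  · refine Matrix.mem_specialUnitaryGroup_iff.2 ⟨hsmul _ hCU, ?_⟩
    rw [Matrix.det_smul, Fintype.card_fin, ← Circle.coe_pow, ← zpow_natCast, ← zpow_mul, ← hα,
      ← Circle.coe_mul, ← zpow_add]
    simp
  · rw [hblock, smMatrix]
    dsimp only
    rw [smul_smul, smul_smul, ← Circle.coe_mul, ← Circle.coe_mul, ← zpow_add, ← zpow_add]
    simp

/-! ### The stabiliser of `1` and of the line of `e₄ ∧ e₅` -/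

theorem mem_GSM_iff (g : Spin10) : g ∈ GSM ↔ ∃ x : SM, spinRep g = smRep x := by
  rw [GSM, Subgroup.mem_comap, MonoidHom.mem_range]
  constructor
  · rintro ⟨x, hx⟩
    exact ⟨x, (congrArg Units.val hx).symm⟩
  · rintro ⟨x, hx⟩
    exact ⟨x, Units.ext hx.symm⟩

theorem exists_spinRep_cliff (g : Spin10) (v : V) :
    ∃ v', ∀ x, spinRep g (cliff v x) = cliff v' (spinRep g x) := by
  obtain ⟨v', hv'⟩ := spinGroup.conjAct_smul_ι_mem_range_ι (x := spinGroup.toUnits g) g.2 v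
  refine ⟨v', fun x => ?_⟩
  have h : CliffordAlgebra.ι Q v' * (g : CliffordAlgebra Q) =
      (g : CliffordAlgebra Q) * CliffordAlgebra.ι Q v := by
    rw [hv', ConjAct.units_smul_def, ConjAct.ofConjAct_toConjAct, mul_assoc,
      show (g : CliffordAlgebra Q) = (spinGroup.toUnits g : CliffordAlgebra Q) from rfl,
      Units.inv_mul, mul_one]
  have h2 := congrArg (fun a => cliffordRep a x) h
  simp only [map_mul, Module.End.mul_apply] at h2
  have h3 : ∀ v, cliffordRep (CliffordAlgebra.ι Q v) = cliff v :=
    fun v => CliffordAlgebra.lift_ι_apply _ _ _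
  rw [h3, h3] at h2
  exact h2.symm

/-- Elements of `Spin(10)` which fix `1` are in `SU(5)`. -/
theorem exists_su5_of_spinRep_one {g : Spin10} (hg : spinRep g 1 = 1) :
    ∃ A ∈ Matrix.specialUnitaryGroup (Fin 5) ℂ, ∀ x, spinRep g x = matrixMap A x := by
  -- Since g fixes 1 and conjugates vectors to vectors, it maps one-forms to one-forms; F is this
  -- restriction, complex linear by construction.
  let F : (Fin 5 → ℂ) →ₗ[ℂ] (Fin 5 → ℂ) :=
    ExteriorAlgebra.ιInv ∘ₗ (spinRep g) ∘ₗ (ExteriorAlgebra.ι ℂ)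
  have hone : ∀ v, cliff v 1 = ExteriorAlgebra.ι ℂ (toComplex v) := by
    intro v
    rw [cliff_eq, contract_one, zero_add, mul_one]
  have hK : ∀ w x, spinRep g (contract (covector (star w)) x + ExteriorAlgebra.ι ℂ w * x) =
      contract (covector (star (F w))) (spinRep g x) +
        ExteriorAlgebra.ι ℂ (F w) * spinRep g x := by
    intro w x
    obtain ⟨v', hv'⟩ := exists_spinRep_cliff g (toComplex.symm w)
    have h1 := hv' 1
    rw [hg, hone, hone, LinearEquiv.apply_symm_apply] at h1
    have h2 : F w = toComplex v' := by
      change ExteriorAlgebra.ιInv (spinRep g (ExteriorAlgebra.ι ℂ w)) = _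
      rw [h1, ExteriorAlgebra.ι_leftInverse]
    have h3 := hv' x
    rw [cliff_eq, cliff_eq, LinearEquiv.apply_symm_apply, ← h2] at h3
    exact h3
  have hI : ∀ w : Fin 5 → ℂ, star (Complex.I • w) = -(Complex.I • star w) := by
    intro w; ext j; simp
  -- Replacing w by i w separates the two halves: the wedge product is linear in w, the contraction
  -- antilinear.
  have hK' : ∀ w x, - spinRep g (contract (covector (star w)) x) +
      spinRep g (ExteriorAlgebra.ι ℂ w * x) =
      - contract (covector (star (F w))) (spinRep g x) +
        ExteriorAlgebra.ι ℂ (F w) * spinRep g x := by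
    intro w x
    have h := hK (Complex.I • w) x
    simp only [map_smul, hI, map_neg, contract, LinearMap.neg_apply, LinearMap.smul_apply,
      smul_mul_assoc, map_add] at h
    have h2 := congrArg (fun y => (-Complex.I) • y) h
    simp only [smul_add, smul_neg, smul_smul, neg_mul, Complex.I_mul_I, neg_neg, one_smul] at h2
    exact h2
  have hι : ∀ w x, spinRep g (ExteriorAlgebra.ι ℂ w * x) =
      ExteriorAlgebra.ι ℂ (F w) * spinRep g x := by
    intro w x
    have h1 := hK w x
    have h2 := hK' w x
    rw [map_add] at h1
    have h3 := congrArg₂ (· + ·) h1 h2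
    have h4 : (2 : ℂ) • spinRep g (ExteriorAlgebra.ι ℂ w * x) =
        (2 : ℂ) • (ExteriorAlgebra.ι ℂ (F w) * spinRep g x) := by
      rw [two_smul, two_smul]
      refine Eq.trans ?_ (h3.trans ?_)
      · abel
      · abel
    exact smul_right_injective _ (two_ne_zero' ℂ) h4
  have hc : ∀ w x, spinRep g (contract (covector (star w)) x) =
      contract (covector (star (F w))) (spinRep g x) := by
    intro w x
    have h1 := hK w x
    rw [map_add, hι] at h1
    exact add_right_cancel h1
  let A := LinearMap.toMatrix' F
  have hAF : ∀ w, A.mulVec w = F w := fun w => LinearMap.toMatrix'_mulVec F w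
  have hA : ∀ x, spinRep g x = matrixMap A x := by
    intro x
    induction x using polyform_induction with
    | algebraMap r =>
      rw [AlgHom.commutes, Algebra.algebraMap_eq_smul_one, map_smul, hg]
    | add x y hx hy => rw [map_add, map_add, hx, hy]
    | ι_mul w x hx => rw [hι, map_mul, matrixMap_ι, hAF, hx]
  have hinner : ∀ w v, covector (star (F w)) (F v) = covector (star w) v := by
    intro w v
    have h1 := hc w (ExteriorAlgebra.ι ℂ v * 1)
    rw [hι, contract_ι_mul, contract_ι_mul, hg, contract_one, contract_one, mul_zero, mul_zero,
      sub_zero, sub_zero, map_smul, hg] at h1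
    exact (smul_left_injective ℂ (one_ne_zero (α := S)) h1).symm
  refine ⟨A, Matrix.mem_specialUnitaryGroup_iff.2 ⟨?_, ?_⟩, hA⟩
  · rw [Matrix.mem_unitaryGroup_iff']
    ext i j
    have h1 := hinner (Pi.single i 1) (Pi.single j 1)
    rw [← hAF, ← hAF, Matrix.mulVec_single_one, Matrix.mulVec_single_one, covector_apply,
      covector_apply] at h1
    rw [Matrix.mul_apply, Matrix.one_apply]
    refine Eq.trans ?_ (h1.trans ?_)
    · rfl
    · simp [Pi.single_apply, eq_comm]
  · have h1 := pairing_spinRep g 1 volume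
    rw [hg, hA, pairing_one, pairing_one, matrixMap_volume, top_volume] at h1
    exact h1

theorem contract_e_mul_e (k : Fin 3) :
    contract (covector (Pi.single (Fin.castAdd 2 k) 1)) (e 3 * e 4) = 0 := by
  rw [contract_e _ _ (by fin_cases k <;> decide), ← mul_one (e 4),
    contract_e _ _ (by fin_cases k <;> decide), contract_one]
  simp

theorem contract_e_self (j : Fin 5) (x : S) :
    contract (covector (Pi.single j 1)) (e j * x) =
      x - e j * contract (covector (Pi.single j 1)) x := by
  rw [e, contract_ι_mul, covector_apply]
  simp [Pi.single_apply]

theorem contract_three_e_mul_e : contract (covector (Pi.single 3 1)) (e 3 * e 4) = e 4 := by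
  rw [contract_e_self, ← mul_one (e 4), contract_e _ _ (by decide), contract_one]
  simp

theorem e_ne_zero (j : Fin 5) : e j ≠ 0 := by
  rw [e, Ne, ExteriorAlgebra.ι_eq_zero_iff]
  intro h
  simpa using congrFun h j

theorem e_mul_e_ne_zero : e 3 * e 4 ≠ 0 := by
  intro h
  have := contract_three_e_mul_e
  rw [h, map_zero] at this
  exact e_ne_zero 4 this.symm

/-- The plane ℂ² consists of the vectors whose wedge product with `e 3 * e 4` vanishes, so A
preserves it; contraction with a coordinate of ℂ³ reads off the entry. -/
theorem matrix_castAdd_natAdd_eq_zero {A : Matrix (Fin 5) (Fin 5) ℂ} {c : ℂ} (hc : c ≠ 0)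
    (h : matrixMap A (e 3 * e 4) = c • (e 3 * e 4)) (i : Fin 3) (j : Fin 2) :
    A (Fin.castAdd 2 i) (Fin.natAdd 3 j) = 0 := by
  have h0 : e (Fin.natAdd 3 j) * (e 3 * e 4) = 0 := by
    fin_cases j
    · change e 3 * (e 3 * e 4) = 0
      rw [← mul_assoc, e_mul_self, zero_mul]
    · change e 4 * (e 3 * e 4) = 0
      rw [← mul_assoc, e_mul_e_swap, neg_mul, mul_assoc, e_mul_self, mul_zero, neg_zero]
  have h1 := congrArg (matrixMap A) h0
  rw [map_mul, h, map_zero, matrixMap_e, mul_smul_comm] at h1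
  have h2 := (smul_eq_zero.1 h1).resolve_left hc
  have h3 := congrArg (contract (covector (Pi.single (Fin.castAdd 2 i) 1))) h2
  rw [contract_ι_mul, contract_e_mul_e, mul_zero, sub_zero, map_zero, covector_single] at h3
  exact (smul_eq_zero.1 h3).resolve_right e_mul_e_ne_zero

/-- The stabiliser of the directions of the sterile neutrino and of `ē`. -/
theorem stab_eq_GSM {c c' : ℂ} (hc : c ≠ 0) (hc' : c' ≠ 0) :
    stab (c • 1) (c' • (e 3 * e 4)) = GSM := by
  ext g
  rw [mem_GSM_iff]
  constructor
  · rintro ⟨h1, t, h2⟩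
    rw [map_smul] at h1 h2
    have h1' : spinRep g 1 = 1 := smul_right_injective S hc h1
    rw [smul_comm] at h2
    have h2' : spinRep g (e 3 * e 4) = (t : ℂ) • (e 3 * e 4) := smul_right_injective S hc' h2
    obtain ⟨A, hA, hgA⟩ := exists_su5_of_spinRep_one h1'
    rw [hgA] at h2'
    have ht : (t : ℂ) ≠ 0 := Circle.coe_ne_zero t
    have hU := (Matrix.mem_specialUnitaryGroup_iff.1 hA).1
    -- The inverse `star A` preserves the same line, so the other off-diagonal block of A vanishes
    -- too.
    have hstar : matrixMap (star A) (e 3 * e 4) = (t : ℂ)⁻¹ • (e 3 * e 4) := by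
      have h3 := congrArg (matrixMap (star A)) h2'
      rw [map_smul] at h3
      have h4 : ∀ x, matrixMap (star A) (matrixMap A x) = x := by
        intro x
        rw [← AlgHom.comp_apply, matrixMap, matrixMap, ExteriorAlgebra.map_comp_map,
          ← Matrix.toLin'_mul, Matrix.mem_unitaryGroup_iff'.1 hU, Matrix.toLin'_one,
          ExteriorAlgebra.map_id]
        rfl
      rw [h4] at h3
      conv_rhs => rw [h3]
      rw [smul_smul, inv_mul_cancel₀ ht, one_smul]
    obtain ⟨x, hx⟩ := exists_smMatrix_eq hA (matrix_castAdd_natAdd_eq_zero ht h2') fun i j => by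
      have := matrix_castAdd_natAdd_eq_zero (inv_ne_zero ht) hstar j i
      rwa [Matrix.star_apply, star_eq_zero] at this
    refine ⟨x, LinearMap.ext fun y => ?_⟩
    rw [hgA, smRep_apply, hx]
  · rintro ⟨x, hx⟩
    refine ⟨?_, x.2.2 ^ (6 : ℤ), ?_⟩
    · rw [hx, map_smul, smRep_one]
    · rw [hx, map_smul, smRep_e_mul_e, smul_comm]

/-! ### Weights -/

theorem matrixMap_diagonal_wedgeBasis (t : Fin 5 → ℂ) (I : Finset (Fin 5)) :
    matrixMap (Matrix.diagonal t) (wedgeBasis I) = (∏ i ∈ I, t i) • wedgeBasis I := by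
  let s : Set.powersetCard (Fin 5) I.card := ⟨I, rfl⟩
  let f := Set.powersetCard.ofFinEmbEquiv.symm s
  have hI : wedgeBasis I = ExteriorAlgebra.ιMulti ℂ I.card (Pi.basisFun ℂ (Fin 5) ∘ f) :=
    ExteriorAlgebra.basis_apply_powersetCard (Pi.basisFun ℂ (Fin 5)) s
  have hprod : ∏ i ∈ I, t i = ∏ k, t (f k) := by
    have : I = Finset.univ.image f := by
      ext i
      rw [Finset.mem_image]
      simp only [Finset.mem_univ, true_and]
      exact (Set.powersetCard.mem_range_ofFinEmbEquiv_symm_iff_mem s i).symm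
    conv_lhs => rw [this]
    rw [Finset.prod_image]
    exact f.injective.injOn
  rw [hI, matrixMap, ExteriorAlgebra.map_apply_ιMulti, hprod, ← AlternatingMap.map_smul_univ]
  congr 1
  ext k j
  simp only [Function.comp_apply, Pi.basisFun_apply, Matrix.toLin'_apply, Matrix.mulVec_diagonal,
    Pi.smul_apply, smul_eq_mul, Pi.single_apply]
  split_ifs with h
  · rw [h]
  · simp

theorem repr_matrixMap_diagonal (t : Fin 5 → ℂ) (x : S) (I : Finset (Fin 5)) :
    wedgeBasis.repr (matrixMap (Matrix.diagonal t) x) I = (∏ i ∈ I, t i) * wedgeBasis.repr x I := by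
  conv_lhs => rw [← wedgeBasis.sum_repr x, map_sum]
  simp only [map_smul, matrixMap_diagonal_wedgeBasis, map_sum, Finsupp.coe_finsetSum,
    Finset.sum_apply, Module.Basis.repr_self, Finsupp.coe_smul, Pi.smul_apply, smul_eq_mul]
  rw [Finset.sum_eq_single I]
  · rw [Finsupp.single_eq_same]; ring
  · intro J _ hJ
    rw [Finsupp.single_eq_of_ne hJ.symm]; ring
  · simp

theorem parity_eq_matrixMap (x : S) : parity x = matrixMap (Matrix.diagonal fun _ => -1) x := by
  have : parity = matrixMap (Matrix.diagonal fun _ => -1) := by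
    refine ExteriorAlgebra.hom_ext (LinearMap.ext fun w => ?_)
    change parity (ExteriorAlgebra.ι ℂ w) = matrixMap _ (ExteriorAlgebra.ι ℂ w)
    rw [matrixMap_ι, CliffordAlgebra.involute_ι, ← map_neg]
    congr 1
    ext j
    simp [Matrix.mulVec_diagonal]
  rw [this]

theorem even_card_of_parity {x : S} (hx : parity x = x) {I : Finset (Fin 5)}
    (hI : wedgeBasis.repr x I ≠ 0) : Even I.card := by
  have h := repr_matrixMap_diagonal (fun _ => -1) x I
  rw [← parity_eq_matrixMap, hx, Finset.prod_const] at h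
  by_contra hodd
  rw [Nat.not_even_iff_odd] at hodd
  rw [hodd.neg_one_pow] at h
  apply hI
  have : 2 * wedgeBasis.repr x I = 0 := by linear_combination h
  exact (mul_eq_zero.1 this).resolve_left two_ne_zero

/-- A primitive root of unity of order `31`. -/
def zeta : ℂ := Complex.exp (2 * Real.pi * Complex.I / (31 : ℕ))

theorem isPrimitiveRoot_zeta : IsPrimitiveRoot zeta 31 := Complex.isPrimitiveRoot_exp 31 (by norm_num)

/-- An element of a maximal torus for which the weights of all even wedge products of the `e i`
are different. -/
theorem exists_smMatrix_eq_diagonal :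
    ∃ x : SM, smMatrix x = Matrix.diagonal fun i : Fin 5 => zeta ^ 2 ^ (i : ℕ) := by
  have hz : zeta * star zeta = 1 := by
    rw [Complex.star_def, Complex.mul_conj', isPrimitiveRoot_zeta.norm'_eq_one (by norm_num)]
    simp
  refine exists_smMatrix_eq (Matrix.mem_specialUnitaryGroup_iff.2 ⟨?_, ?_⟩) ?_ ?_
  · rw [Matrix.mem_unitaryGroup_iff, Matrix.star_eq_conjTranspose, Matrix.diagonal_conjTranspose,
      Matrix.diagonal_mul_diagonal, ← Matrix.diagonal_one]
    congr 1
    ext i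
    rw [Pi.star_apply, star_pow, ← mul_pow, hz, one_pow]
  -- The exponents add up to 1 + 2 + 4 + 8 + 16 = 31, the order of `zeta`.
  · rw [Matrix.det_diagonal, Fin.prod_univ_five]
    simp only [← pow_add]
    exact isPrimitiveRoot_zeta.pow_eq_one
  · intro i j
    rw [Matrix.diagonal_apply_ne]
    intro h
    have := congrArg Fin.val h
    simp at this
    omega
  · intro i j
    rw [Matrix.diagonal_apply_ne]
    intro h
    have := congrArg Fin.val h
    simp at this
    omega

/-- By uniqueness of binary digits the only collision modulo 31 is between the empty and the full
set, and the latter has odd size. -/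
theorem sum_two_pow_mod_injective : ∀ I J : Finset (Fin 5), Even I.card → Even J.card →
    (∑ i ∈ I, 2 ^ (i : ℕ)) % 31 = (∑ i ∈ J, 2 ^ (i : ℕ)) % 31 → I = J := by
  decide +kernel

theorem mod_eq_of_zeta_pow_eq {m n : ℕ} (h : zeta ^ m = zeta ^ n) : m % 31 = n % 31 := by
  rw [← pow_mod_orderOf zeta m, ← pow_mod_orderOf zeta n, ← isPrimitiveRoot_zeta.eq_orderOf] at h
  exact isPrimitiveRoot_zeta.pow_inj (Nat.mod_lt _ (by norm_num)) (Nat.mod_lt _ (by norm_num)) h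

theorem eq_smul_wedgeBasis {x : SM}
    (hx : smMatrix x = Matrix.diagonal fun i : Fin 5 => zeta ^ 2 ^ (i : ℕ)) {ψ : S}
    (hψ : parity ψ = ψ) {c : ℂ} (h : smRep x ψ = c • ψ) {J : Finset (Fin 5)}
    (hJ : Even J.card) (hc : ψ ≠ 0 → c = zeta ^ ∑ i ∈ J, 2 ^ (i : ℕ)) :
    ψ = wedgeBasis.repr ψ J • wedgeBasis J := by
  conv_lhs => rw [← wedgeBasis.sum_repr ψ]
  refine Finset.sum_eq_single J (fun I _ hIJ => ?_) (by simp)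
  by_cases hI : wedgeBasis.repr ψ I = 0
  · rw [hI, zero_smul]
  · exfalso
    have hψ0 : ψ ≠ 0 := by
      rintro rfl
      simp at hI
    have h1 := repr_matrixMap_diagonal (fun i : Fin 5 => zeta ^ 2 ^ (i : ℕ)) ψ I
    rw [← hx, ← smRep_apply, h, map_smul, Finsupp.smul_apply, smul_eq_mul,
      Finset.prod_pow_eq_pow_sum] at h1
    have h2 := mul_right_cancel₀ hI h1
    rw [hc hψ0] at h2
    exact hIJ (sum_two_pow_mod_injective _ _ (even_card_of_parity hψ hI) hJ
      (mod_eq_of_zeta_pow_eq h2.symm))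

theorem exists_eq_smul_wedgeBasis {x : SM}
    (hx : smMatrix x = Matrix.diagonal fun i : Fin 5 => zeta ^ 2 ^ (i : ℕ)) {ψ : S}
    (hψ : parity ψ = ψ) {c : ℂ} (h : smRep x ψ = c • ψ) (hψ0 : ψ ≠ 0) :
    ∃ J : Finset (Fin 5), Even J.card ∧ ∃ r : ℂ, r ≠ 0 ∧ ψ = r • wedgeBasis J := by
  obtain ⟨J, hJ⟩ : ∃ J, wedgeBasis.repr ψ J ≠ 0 := by
    by_contra! h0
    exact hψ0 (wedgeBasis.repr.map_eq_zero_iff.1 (Finsupp.ext h0))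
  have h1 := repr_matrixMap_diagonal (fun i : Fin 5 => zeta ^ 2 ^ (i : ℕ)) ψ J
  rw [← hx, ← smRep_apply, h, map_smul, Finsupp.smul_apply, smul_eq_mul,
    Finset.prod_pow_eq_pow_sum] at h1
  exact ⟨J, even_card_of_parity hψ hJ, _, hJ, eq_smul_wedgeBasis hx hψ h (even_card_of_parity hψ hJ)
    fun _ => mul_right_cancel₀ hJ h1⟩

theorem wedgeBasis_three_four : e 3 * e 4 = wedgeBasis {3, 4} ∨ e 3 * e 4 = - wedgeBasis {3, 4} := by
  rw [← wedgeBasis_singleton 4]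
  exact e_mul_wedgeBasis_of_notMem (by decide)

theorem wedgeBasis_three_four_mem : wedgeBasis {3, 4} ∈ Submodule.span ℂ {e 3 * e 4} := by
  rcases wedgeBasis_three_four with h | h
  · rw [← h]
    exact Submodule.mem_span_singleton_self _
  · rw [eq_neg_iff_add_eq_zero, add_comm, ← eq_neg_iff_add_eq_zero] at h
    rw [h]
    exact neg_mem (Submodule.mem_span_singleton_self _)

/-- The direction of the sterile neutrino. -/
theorem sterileNeutrino_eq : sterileNeutrino = Submodule.span ℂ {1} := by
  apply le_antisymm
  · rintro ψ ⟨hψ, h⟩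
    obtain ⟨x, hx⟩ := exists_smMatrix_eq_diagonal
    have h1 := eq_smul_wedgeBasis hx (parity_of_mem_Splus hψ) (h x) (J := ∅) (by simp)
      (by simp)
    rw [h1, wedgeBasis_empty]
    exact Submodule.smul_mem _ _ (Submodule.mem_span_singleton_self _)
  · rw [Submodule.span_singleton_le_iff_mem]
    refine ⟨Submodule.one_le.1 (CliffordAlgebra.one_le_evenOdd_zero _), fun x => ?_⟩
    rw [smRep_one]
    simp

/-- The direction `ē`. -/
theorem positron_eq : positron = Submodule.span ℂ {e 3 * e 4} := by
  apply le_antisymm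
  · rintro ψ ⟨hψ, h⟩
    obtain ⟨x, hx⟩ := exists_smMatrix_eq_diagonal
    have h1 := eq_smul_wedgeBasis hx (parity_of_mem_Splus hψ) (h x) (J := {3, 4}) (by decide) (by
      intro _
      have h2 := smRep_e_mul_e x
      rw [smRep_apply, hx] at h2
      have h3 : matrixMap (Matrix.diagonal fun i : Fin 5 => zeta ^ 2 ^ (i : ℕ)) (e 3 * e 4) =
          (∏ i ∈ {3, 4}, zeta ^ 2 ^ ((i : Fin 5) : ℕ)) • (e 3 * e 4) := by
        rcases wedgeBasis_three_four with h | h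
        · rw [h, matrixMap_diagonal_wedgeBasis]
        · rw [h, map_neg, matrixMap_diagonal_wedgeBasis, smul_neg]
      rw [h3, Finset.prod_pow_eq_pow_sum] at h2
      exact (smul_left_injective ℂ e_mul_e_ne_zero h2).symm)
    rw [h1]
    exact Submodule.smul_mem _ _ wedgeBasis_three_four_mem
  · rw [Submodule.span_singleton_le_iff_mem]
    exact ⟨CliffordAlgebra.ι_mul_ι_mem_evenOdd_zero _ _ _, smRep_e_mul_e⟩

/-! ### The pair given by `1` and `e₄ ∧ e₅` -/

theorem isPure_smul_iff {c : ℂ} (hc : c ≠ 0) (ψ : S) : IsPure (c • ψ) ↔ IsPure ψ := by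
  have : nullSpace (c • ψ) = nullSpace ψ := by
    ext z
    change cliffC z (c • ψ) = 0 ↔ cliffC z ψ = 0
    rw [map_smul, smul_eq_zero]
    simp [hc]
  rw [IsPure, IsPure, this]

theorem scalarPart_e_mul (j : Fin 5) (x : S) : scalarPart (e j * x) = 0 := scalarPart_ι_mul _ _

/-- Each contraction of this spinor is a one-form in the span of `e 3` and `e 4`, which wedges `e 3
* e 4` to zero; its negative is the required vector. -/
theorem isPure_one_add (b : ℂ) : IsPure (1 + b • (e 3 * e 4)) := by
  rw [isPure_iff_of_scalarPart_ne_zero (by simp [scalarPart_e_mul])]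
  intro u
  have hu : contract (covector u) (e 3 * e 4) = u 3 • e 4 - u 4 • e 3 := by
    rw [e, e, contract_ι_mul, ← mul_one (ExteriorAlgebra.ι ℂ (Pi.single 4 1)), contract_ι_mul,
      contract_one]
    simp [covector_apply, Pi.single_apply]
  refine ⟨-(b • (u 3 • Pi.single 4 1 - u 4 • Pi.single 3 1)), ?_⟩
  have hw : ExteriorAlgebra.ι ℂ (-(b • (u 3 • Pi.single 4 1 - u 4 • Pi.single 3 1))) =
      -(b • (u 3 • e 4 - u 4 • e 3)) := by
    simp only [map_neg, map_smul, map_sub, e]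
  have h0 : (u 3 • e 4 - u 4 • e 3) * (e 3 * e 4) = 0 := by
    rw [sub_mul, smul_mul_assoc, smul_mul_assoc, ← mul_assoc, ← mul_assoc, e_mul_self, e_mul_e_swap,
      neg_mul, mul_assoc, e_mul_self]
    simp
  rw [hw, map_add, contract_one, map_smul, hu, mul_add, mul_smul_comm, neg_mul (b • _) (_ * _),
    smul_mul_assoc, h0]
  simp

theorem isPure_e_mul_e : IsPure (e 3 * e 4) := by
  have h1 : IsPure 1 := by simpa using isPure_one_add 0
  have h : e 3 * e 4 = cliff (EuclideanSpace.single 8 1) (cliff (EuclideanSpace.single 9 1) 1) := by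
    rw [cliff_single, cliff_single, show (8 : Fin 10) = Fin.natAdd 5 (3 : Fin 5) from rfl,
      show (9 : Fin 10) = Fin.natAdd 5 (4 : Fin 5) from rfl, Gam_natAdd, Gam_natAdd, contract_one,
      zero_add, contract_e _ _ (by decide), contract_one]
    simp
  rw [h, isPure_cliff_iff (by simp), isPure_cliff_iff (by simp)]
  exact h1

theorem purePair_smul_one {c c' : ℂ} (hc : c ≠ 0) (hc' : c' ≠ 0) :
    PurePair (c • 1) (c' • (e 3 * e 4)) := by
  have hcomb : ∀ a b : ℂ, a ≠ 0 ∨ b ≠ 0 → IsPure (a • 1 + b • (e 3 * e 4)) := by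
    intro a b hab
    by_cases ha : a = 0
    · rw [ha, zero_smul, zero_add, isPure_smul_iff (hab.resolve_left (not_not.2 ha))]
      exact isPure_e_mul_e
    · have : a • (1 : S) + b • (e 3 * e 4) = a • (1 + (a⁻¹ * b) • (e 3 * e 4)) := by
        rw [smul_add, smul_smul, mul_inv_cancel_left₀ ha]
      rw [this, isPure_smul_iff ha]
      exact isPure_one_add _
  refine ⟨by simpa using hcomb c 0 (Or.inl hc), by simpa using hcomb 0 c' (Or.inr hc'), ?_, ?_⟩
  · rw [orthogonal_smul_one_iff hc, map_smul, scalarPart_e_mul, smul_zero]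
  · intro a b hab
    rw [smul_smul, smul_smul]
    refine hcomb _ _ ?_
    by_contra! h
    apply hab
    rw [mul_eq_zero, mul_eq_zero] at h
    rw [h.1.resolve_right hc, h.2.resolve_right hc']

/-! ### Conjugation of stabilisers -/

theorem mem_stab_iff (Ψ₁ Ψ₂ : S) (g : Spin10) : g ∈ stab Ψ₁ Ψ₂ ↔
    spinRep g Ψ₁ = Ψ₁ ∧ ∃ c : Circle, spinRep g Ψ₂ = (c : ℂ) • Ψ₂ := Iff.rfl

theorem stab_eq_map_conj (k : Spin10) (Ψ₁ Ψ₂ : S) :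
    stab Ψ₁ Ψ₂ = (stab (spinRep k Ψ₁) (spinRep k Ψ₂)).map (MulAut.conj k⁻¹).toMonoidHom := by
  have hle : ∀ (k : Spin10) (Ψ₁ Ψ₂ : S), ∀ g ∈ stab Ψ₁ Ψ₂,
      k * g * k⁻¹ ∈ stab (spinRep k Ψ₁) (spinRep k Ψ₂) := by
    rintro k Ψ₁ Ψ₂ g ⟨h1, c, h2⟩
    have h : ∀ ψ, spinRep (k * g * k⁻¹) (spinRep k ψ) = spinRep k (spinRep g ψ) := by
      intro ψ
      rw [map_mul, Module.End.mul_apply, spinRep_inv_apply, map_mul, Module.End.mul_apply]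
    exact ⟨by rw [h, h1], c, by rw [h, h2, map_smul]⟩
  ext g
  constructor
  · intro hg
    refine ⟨k * g * k⁻¹, hle k _ _ g hg, ?_⟩
    simp [mul_assoc]
  · rintro ⟨g', hg', rfl⟩
    have := hle k⁻¹ _ _ g' hg'
    rw [spinRep_inv_apply, spinRep_inv_apply] at this
    exact this

/-- `R` is injective, commutes with Spin(10), and turns a phase into its conjugate. -/
theorem stab_R (Ψ₁ Ψ₂ : S) : stab (R Ψ₁) (R Ψ₂) = stab Ψ₁ Ψ₂ := by
  ext g
  rw [mem_stab_iff, mem_stab_iff, ← R_spinRep, ← R_spinRep, R_injective.eq_iff]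
  refine and_congr_right fun _ => ⟨?_, ?_⟩
  · rintro ⟨c, hc⟩
    refine ⟨c⁻¹, R_injective ?_⟩
    rw [hc, R_smul, Circle.coe_inv_eq_conj, Complex.conj_conj]
  · rintro ⟨c, hc⟩
    refine ⟨c⁻¹, ?_⟩
    rw [hc, R_smul, Circle.coe_inv_eq_conj]

theorem PurePair.exists_spin {Ψ₁ Ψ₂ : S} (h : PurePair Ψ₁ Ψ₂) :
    ∃ k : Spin10, stab Ψ₁ Ψ₂ = GSM.map (MulAut.conj k⁻¹).toMonoidHom ∧
      (Ψ₁ ∈ Splus → spinRep k Ψ₁ ∈ sterileNeutrino ∧ spinRep k Ψ₂ ∈ positron) := by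
  obtain ⟨l, hl, c, c', hc, hc', h1, h2⟩ := h.exists_cliffProd
  rcases Nat.even_or_odd l.length with heven | hodd
  · obtain ⟨k, hk⟩ := hl.exists_spinRep_eq heven
    refine ⟨k, ?_, fun _ => ?_⟩
    · rw [stab_eq_map_conj k, hk, h1, h2, stab_eq_GSM hc hc']
    · rw [hk, h1, h2, sterileNeutrino_eq, positron_eq]
      exact ⟨Submodule.smul_mem _ _ (Submodule.mem_span_singleton_self _),
        Submodule.smul_mem _ _ (Submodule.mem_span_singleton_self _)⟩
  -- These five vectors undo the generators in `R`: the even product `m ++ l` acts on `R ψ` as the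
  -- conjugate of `cliffProd l ψ`, and conjugation preserves the normal form.
  · let m : List V := [EuclideanSpace.single 9 1, EuclideanSpace.single 8 1,
      EuclideanSpace.single 7 1, EuclideanSpace.single 6 1, EuclideanSpace.single 5 1]
    have hm : IsUnitList m := by
      intro v hv
      simp only [m, List.mem_cons, List.not_mem_nil, or_false] at hv
      rcases hv with rfl | rfl | rfl | rfl | rfl <;> simp
    obtain ⟨k, hk⟩ := (hm.append hl).exists_spinRep_eq (by
      rw [List.length_append]
      exact Odd.add_odd (by decide) hodd)
    have hkR : ∀ ψ, spinRep k (R ψ) = conjS (cliffProd l ψ) := by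
      intro ψ
      rw [hk, cliffProd_append, ← R_cliffProd, ← Gam_mul_R]
      simp only [m, cliffProd_cons, cliffProd_nil, cliff_single]
    refine ⟨k, ?_, fun hS => ?_⟩
    · rw [← stab_R, stab_eq_map_conj k, hkR, hkR, h1, h2, conjS_smul, conjS_smul, conjS_one,
        conjS_e_mul, ← mul_one (e 4), conjS_e_mul, conjS_one, mul_one,
        stab_eq_GSM (by simpa using hc) (by simpa using hc')]
    -- An odd product cannot carry an even spinor to a non-zero multiple of 1.
    · exfalso
      have h3 := parity_cliffProd l Ψ₁
      rw [parity_of_mem_Splus hS, h1, map_smul, map_one, hodd.neg_one_pow, neg_one_smul] at h3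
      have h4 : (2 * c) • (1 : S) = 0 := by
        rw [two_mul, add_smul]
        nth_rw 1 [h3]
        simp
      rcases smul_eq_zero.1 h4 with h4 | h4
      · exact hc (by simpa using h4)
      · exact one_ne_zero h4

/-! ### Spinors with stabiliser `G_SM` -/

/-- A signed permutation that is transitive on the coordinates of each block; the minus sign gives
the swap in ℂ² determinant 1. -/
theorem exists_smMatrix_cycle : ∃ x : SM, (smMatrix x).col 0 = Pi.single 1 1 ∧
    (smMatrix x).col 1 = Pi.single 2 1 ∧ (smMatrix x).col 2 = Pi.single 0 1 ∧
    (smMatrix x).col 3 = Pi.single 4 1 ∧ (smMatrix x).col 4 = - Pi.single 3 1 := by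
  obtain ⟨x, hx⟩ := exists_smMatrix_eq
    (A := !![0, 0, 1, 0, 0; 1, 0, 0, 0, 0; 0, 1, 0, 0, 0; 0, 0, 0, 0, -1; 0, 0, 0, 1, 0])
    (Matrix.mem_specialUnitaryGroup_iff.2 ⟨by
      rw [Matrix.mem_unitaryGroup_iff]
      ext i j
      rw [Matrix.mul_apply, Fin.sum_univ_five]
      fin_cases i <;> fin_cases j <;> simp [Matrix.star_apply], by
      simp [Matrix.det_succ_row_zero, Fin.sum_univ_succ, Fin.succAbove]⟩)
    (by intro i j; fin_cases i <;> fin_cases j <;> rfl)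
    (by intro i j; fin_cases i <;> fin_cases j <;> rfl)
  refine ⟨x, ?_⟩
  rw [hx]
  refine ⟨?_, ?_, ?_, ?_, ?_⟩ <;> ext i <;> fin_cases i <;> simp

theorem wedgeBasis_mem_iff {j : Fin 5} {J : Finset (Fin 5)} : j ∈ J ↔ e j * wedgeBasis J = 0 := by
  refine ⟨e_mul_wedgeBasis_of_mem, fun h => ?_⟩
  by_contra hj
  have h0 : ∀ I, wedgeBasis I ≠ 0 := fun I => wedgeBasis.ne_zero I
  rcases e_mul_wedgeBasis_of_notMem hj with h' | h'
  · exact h0 _ (h'.symm.trans h)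
  · exact h0 _ (neg_eq_zero.1 (h'.symm.trans h))

/-- J is a union of blocks of sizes 3 and 2, and the only non-empty one of even size is the second
block. -/
theorem eq_three_four_of_cycle : ∀ J : Finset (Fin 5), Even J.card → J ≠ ∅ → (0 ∈ J → 1 ∈ J) →
    (1 ∈ J → 2 ∈ J) → (2 ∈ J → 0 ∈ J) → (3 ∈ J → 4 ∈ J) → (4 ∈ J → 3 ∈ J) → J = {3, 4} := by
  decide +kernel

theorem PurePair.mem_of_stab_eq_GSM {Ψ₁ Ψ₂ : S} (h : PurePair Ψ₁ Ψ₂) (hS : Ψ₁ ∈ Splus)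
    (hstab : stab Ψ₁ Ψ₂ = GSM) : Ψ₁ ∈ sterileNeutrino ∧ Ψ₂ ∈ positron := by
  have hinv : ∀ x : SM, smRep x Ψ₁ = Ψ₁ ∧ ∃ c : ℂ, c ≠ 0 ∧ smRep x Ψ₂ = c • Ψ₂ := by
    intro x
    obtain ⟨l, hl, heven, hlx⟩ := exists_cliffProd_eq_su5Rep (smToSU5 x)
    obtain ⟨g, hg⟩ := hl.exists_spinRep_eq heven
    have hgx : spinRep g = smRep x := hg.trans hlx
    have hmem : g ∈ stab Ψ₁ Ψ₂ := by
      rw [hstab, mem_GSM_iff]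
      exact ⟨x, hgx⟩
    obtain ⟨h1, c, h2⟩ := hmem
    rw [hgx] at h1 h2
    exact ⟨h1, c, Circle.coe_ne_zero c, h2⟩
  have h1 : Ψ₁ ∈ sterileNeutrino := ⟨hS, fun x => by rw [(hinv x).1]; simp⟩
  refine ⟨h1, ?_⟩
  rw [sterileNeutrino_eq, Submodule.mem_span_singleton] at h1
  obtain ⟨c, rfl⟩ := h1
  have hc : c ≠ 0 := by
    rintro rfl
    exact h.pure_left.ne_zero (zero_smul _ _)
  -- Evenness of the second spinor is not assumed: it follows from its decomposability as a product
  -- of two one-forms.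
  have hpar : parity Ψ₂ = Ψ₂ := by
    obtain ⟨w, u, rfl⟩ := h.exists_eq_ι_mul_ι
    rw [map_mul, CliffordAlgebra.involute_ι, CliffordAlgebra.involute_ι, neg_mul_neg]
  obtain ⟨x, hx⟩ := exists_smMatrix_eq_diagonal
  obtain ⟨-, t, -, ht⟩ := hinv x
  obtain ⟨J, hJ, r, hr, hΨ⟩ := exists_eq_smul_wedgeBasis hx hpar ht h.pure_right.ne_zero
  have hJ0 : J ≠ ∅ := by
    rintro rfl
    have h0 := (orthogonal_smul_one_iff hc Ψ₂).1 h.orthogonal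
    rw [hΨ, wedgeBasis_empty, map_smul, map_one, smul_eq_mul, mul_one] at h0
    exact hr h0
  obtain ⟨y, hy0, hy1, hy2, hy3, hy4⟩ := exists_smMatrix_cycle
  obtain ⟨-, s, hs, hsy⟩ := hinv y
  -- Membership in J means annihilation by `e i`; since y preserves the line of Ψ₂, the image of `e
  -- i` annihilates it as well.
  have hmove : ∀ i : Fin 5, i ∈ J →
      ExteriorAlgebra.ι ℂ ((smMatrix y).col i) * wedgeBasis J = 0 := by
    intro i hi
    have h2 : e i * Ψ₂ = 0 := by
      rw [hΨ, mul_smul_comm, wedgeBasis_mem_iff.1 hi, smul_zero]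
    have h3 := congrArg (matrixMap (smMatrix y)) h2
    rw [map_mul, ← smRep_apply, ← smRep_apply, hsy, smRep_apply, matrixMap_e, map_zero, hΨ,
      smul_smul, mul_smul_comm] at h3
    exact (smul_eq_zero.1 h3).resolve_left (mul_ne_zero hs hr)
  have hJ34 := eq_three_four_of_cycle J hJ hJ0
    (fun hi => wedgeBasis_mem_iff.2 (by rw [← hmove 0 hi, hy0, e]))
    (fun hi => wedgeBasis_mem_iff.2 (by rw [← hmove 1 hi, hy1, e]))
    (fun hi => wedgeBasis_mem_iff.2 (by rw [← hmove 2 hi, hy2, e]))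
    (fun hi => wedgeBasis_mem_iff.2 (by rw [← hmove 3 hi, hy3, e]))
    (fun hi => wedgeBasis_mem_iff.2 (by
      have := hmove 4 hi
      rwa [hy4, map_neg, neg_mul, neg_eq_zero] at this))
  rw [positron_eq, hΨ, hJ34]
  exact Submodule.smul_mem _ _ wedgeBasis_three_four_mem

end SpinTen

end

theorem theoremA :
    -- `SU(3) × SU(2) × U(1)`, acting on spinors, is realised by elements of `Spin(10)`
    (∀ x : SpinTen.SM, ∃ g : SpinTen.Spin10, SpinTen.spinRep g = SpinTen.smRep x) ∧
    -- the directions of the sterile neutrino and of `ē` are lines, spanned by `1` and `e₄ ∧ e₅`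
    SpinTen.sterileNeutrino = Submodule.span ℂ {1} ∧
    SpinTen.positron = Submodule.span ℂ {SpinTen.e 3 * SpinTen.e 4} ∧
    -- spinors in these directions form a pair as required, and `G_SM` is its stabiliser
    (∀ Ψ₁ ∈ SpinTen.sterileNeutrino, ∀ Ψ₂ ∈ SpinTen.positron, Ψ₁ ≠ 0 → Ψ₂ ≠ 0 →
      SpinTen.PurePair Ψ₁ Ψ₂ ∧ SpinTen.stab Ψ₁ Ψ₂ = SpinTen.GSM) ∧
    -- for every pair, up to conjugation in `Spin(10)`, the stabiliser is `G_SM`, and `Ψ₁`, `Ψ₂`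
    -- have the directions of the sterile neutrino and of `ē`
    (∀ Ψ₁ Ψ₂ : SpinTen.S, SpinTen.PurePair Ψ₁ Ψ₂ →
      ∃ h : SpinTen.Spin10,
        SpinTen.stab Ψ₁ Ψ₂ = SpinTen.GSM.map (MulAut.conj h).toMonoidHom ∧
        (Ψ₁ ∈ SpinTen.Splus →
          SpinTen.spinRep h⁻¹ Ψ₁ ∈ SpinTen.sterileNeutrino ∧
          SpinTen.spinRep h⁻¹ Ψ₂ ∈ SpinTen.positron)) ∧
    -- the stabiliser is `G_SM` itself only for spinors in these two directions
    (∀ Ψ₁ Ψ₂ : SpinTen.S, SpinTen.PurePair Ψ₁ Ψ₂ → Ψ₁ ∈ SpinTen.Splus →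
      SpinTen.stab Ψ₁ Ψ₂ = SpinTen.GSM →
        Ψ₁ ∈ SpinTen.sterileNeutrino ∧ Ψ₂ ∈ SpinTen.positron) := by
  refine ⟨fun x => ?_, SpinTen.sterileNeutrino_eq, SpinTen.positron_eq, ?_, ?_, ?_⟩
  · obtain ⟨l, hl, heven, hlx⟩ := SpinTen.exists_cliffProd_eq_su5Rep (SpinTen.smToSU5 x)
    obtain ⟨g, hg⟩ := hl.exists_spinRep_eq heven
    exact ⟨g, hg.trans hlx⟩
  · intro Ψ₁ h₁ Ψ₂ h₂ hn₁ hn₂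
    rw [SpinTen.sterileNeutrino_eq, Submodule.mem_span_singleton] at h₁
    rw [SpinTen.positron_eq, Submodule.mem_span_singleton] at h₂
    obtain ⟨c, rfl⟩ := h₁
    obtain ⟨c', rfl⟩ := h₂
    have hc : c ≠ 0 := fun h => hn₁ (by rw [h, zero_smul])
    have hc' : c' ≠ 0 := fun h => hn₂ (by rw [h, zero_smul])
    exact ⟨SpinTen.purePair_smul_one hc hc', SpinTen.stab_eq_GSM hc hc'⟩
  · intro Ψ₁ Ψ₂ h
    obtain ⟨k, hk, hk'⟩ := h.exists_spin
    exact ⟨k⁻¹, hk, by rwa [inv_inv]⟩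
  · exact fun Ψ₁ Ψ₂ h hS hstab => h.mem_of_stab_eq_GSM hS hstab
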